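/- Let $M\ge 0$ be an integer and $\bar p=(p_1,\dots,p_M)\in[\tfrac12,1)^M$; put $p_i=\tfrac12$ for $i>M$ and $\alpha=\sum_{i=1}^M(2p_i-1)-1$. An $(M,\bar p)$-cookie random walk started at $x\in\mathbb Z$ is a process $X=(X_n)_{n\ge0}$ with values in $\mathbb Z$ on a probability space such that almost surely $X_0=x$ and $|X_{n+1}-X_n|=1$ for all $n$, and $$\mathbb P\{X_{n+1}=X_n+1\mid X_0,\dots,X_n\}=p_j\quad\text{a.s., where } j=\#\{0\le i\le n:\ X_i=X_n\}.$$ Let $(B_i)_{i\ge1}$ be independent Bernoulli variables with $\mathbf P\{B_i=1\}=p_i=1-\mathbf P\{B_i=0\}$. For $j\ge 0$ let $k_j=\min\{k\ge1:\ \#\{1\le i\le k: B_i=1\}=j+1\}$ and let $A_j=\#\{1\le i\le k_j: B_i=0\}$ be the number of failures before the $(j+1)$-st success. Let $Z=(Z_n)_{n\ge0}$ be, under $\mathbb P_z$, the Markov chain on $\mathbb N=\{0,1,2,\dots\}$ with $Z_0=z$ and transition probabilities $\mathbb P_z\{Z_{n+1}=k\mid Z_n=j\}=\mathbf P\{A_j=k\}$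 (the branching process with migration associated with the cookie random walk). (1) If $\alpha>0$, then there is a probability measure $\pi$ on $\mathbb N$ such that, for every $z\in\mathbb N$, $Z_n$ converges in law under $\mathbb P_z$ to $\pi$; the measure $\pi$ is the unique invariant probability measure of $Z$; and a random variable $Z_\infty$ with law $\pi$ satisfies $$\mathbb E\left[Z_\infty^{M-1}\right]=+\infty.$$ (2) If $M=2$, then for every $\bar p\in[\tfrac12,1)^2$ the speed is zero: every $(2,\bar p)$-cookie random walk $X$, started at any $x\in\mathbb Z$, satisfies $X_n/n\to0$ almost surely. -/

import Mathlib

open MeasureTheory ProbabilityTheory Filter Topology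
open scoped ENNReal

namespace CookieWalk

noncomputable section

/-- A vector of `M` cookie strengths `p_1, …, p_M ∈ [1/2, 1)`.
The strength `p_i` is `p` at index `i - 1`. -/
abbrev Cookies (M : ℕ) : Type := Fin M → Set.Ico (1 / 2 : ℝ) 1

/-- The strength of the cookie number `i` (counted from `0`) at any site: it is given by the
vector `p` for the first `M` cookies, and is `1/2` afterwards. -/
def strength {M : ℕ} (p : Cookies M) (i : ℕ) : unitInterval :=
  if h : i < M then
    ⟨p ⟨i, h⟩, le_trans (by norm_num) (p ⟨i, h⟩).2.1, (p ⟨i, h⟩).2.2.le⟩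
  else ⟨1 / 2, by norm_num, by norm_num⟩

/-- `α(M, p) = ∑ (2 p_i - 1) - 1`. -/
def alpha {M : ℕ} (p : Cookies M) : ℝ := (∑ i, (2 * (p i : ℝ) - 1)) - 1

/-! ### The cookie random walk -/

/-- The number of visits of the path `x` to the site `x n` strictly before time `n`. -/
def visitsBefore (x : ℕ → ℤ) (n : ℕ) : ℕ := ((Finset.range n).filter fun i => x i = x n).card

/-- `X`, defined on a space with measure `μ`, is a cookie random walk started at `x` in the
spatially uniform environment with cookies `p`: it is a nearest neighbour walk, and, given the
path up to time `n`, it jumps to the right with the probability given by the strength of the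
first remaining cookie at its present site. Cookies are counted from `0`, so the cookie to be
eaten at time `n` has for its index the number of earlier visits to the present site. -/
structure IsCookieWalk {M : ℕ} (p : Cookies M) (x : ℤ) {Ω : Type*} [MeasurableSpace Ω]
    (μ : Measure Ω) (X : ℕ → Ω → ℤ) : Prop where
  isProbabilityMeasure : IsProbabilityMeasure μ
  measurable : ∀ n, Measurable (X n)
  start : ∀ᵐ ω ∂μ, X 0 ω = x
  nearest : ∀ n, ∀ᵐ ω ∂μ, |X (n + 1) ω - X n ω| = 1
  jump : ∀ n,
    μ⟦{ω | X (n + 1) ω = X n ω + 1} |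
      MeasurableSpace.comap (fun ω (i : Fin (n + 1)) => X i ω) inferInstance⟧
    =ᵐ[μ] fun ω => (strength p (visitsBefore (fun k => X k ω) n) : ℝ)

/-- The process `X` has almost surely the limiting speed `v`. -/
def HasSpeed {Ω : Type*} [MeasurableSpace Ω] (μ : Measure Ω) (X : ℕ → Ω → ℤ) (v : ℝ) : Prop :=
  ∀ᵐ ω ∂μ, Tendsto (fun n : ℕ => (X n ω : ℝ) / n) atTop (𝓝 v)

/-! ### The associated branching process with migration -/

/-- The law of the sequence `B` of independent Bernoulli variables, where `B i` (with `i`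
counted from `0`) is a success with probability `strength p i`. -/
def bernoulliLaw {M : ℕ} (p : Cookies M) : Measure (ℕ → Bool) :=
  Measure.infinitePi fun i => bernoulliMeasure true false (strength p i)

/-- The number of the `b`'s among the first `k` terms of `B`. -/
def countUpTo (b : Bool) (k : ℕ) (B : ℕ → Bool) : ℕ :=
  ((Finset.range k).filter fun i => B i = b).card

/-- `k_j`: the number of trials needed to get exactly `j + 1` successes (this is almost surely
the minimum of a nonempty set). -/
def trials (j : ℕ) (B : ℕ → Bool) : ℕ := sInf {k | 1 ≤ k ∧ countUpTo true k B = j + 1}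

/-- `A_j`: the number of failures before the success number `j + 1`. -/
def failures (j : ℕ) (B : ℕ → Bool) : ℕ := countUpTo false (trials j B) B

instance {M : ℕ} (p : Cookies M) : IsProbabilityMeasure (bernoulliLaw p) := by
  unfold bernoulliLaw; infer_instance

lemma measurable_countUpTo (b : Bool) (k : ℕ) : Measurable (countUpTo b k) := by
  have : countUpTo b k = fun B => ∑ i ∈ Finset.range k, if B i = b then 1 else 0 := by
    funext B; simp [countUpTo]
  rw [this]
  exact Finset.measurable_sum _ fun i _ =>
    (measurable_of_countable fun c : Bool => if c = b then 1 else 0).comp (measurable_pi_apply i)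

lemma measurable_trials (j : ℕ) : Measurable (trials j) := by
  have hS : ∀ k, MeasurableSet {B : ℕ → Bool | 1 ≤ k ∧ countUpTo true k B = j + 1} := fun k =>
    (MeasurableSet.const _).inter (measurable_countUpTo true k (measurableSet_singleton _))
  refine measurable_of_Iic fun n => ?_
  have : trials j ⁻¹' Set.Iic n =
      (⋃ k ∈ Set.Iic n, {B | 1 ≤ k ∧ countUpTo true k B = j + 1}) ∪
        (⋃ k, {B | 1 ≤ k ∧ countUpTo true k B = j + 1})ᶜ := by
    ext B
    simp only [Set.mem_preimage, Set.mem_Iic, Set.mem_union, Set.mem_iUnion, Set.mem_compl_iff,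
      Set.mem_ofPred_eq, trials, exists_prop]
    constructor
    · intro h
      by_cases hne : ∃ k, 1 ≤ k ∧ countUpTo true k B = j + 1
      · exact Or.inl ⟨_, h, Nat.sInf_mem (s := {k | 1 ≤ k ∧ countUpTo true k B = j + 1}) hne⟩
      · exact Or.inr hne
    · rintro (⟨k, hk, h⟩ | h)
      · exact (Nat.sInf_le (s := {k | 1 ≤ k ∧ countUpTo true k B = j + 1}) h).trans hk
      · have : {k | 1 ≤ k ∧ countUpTo true k B = j + 1} = ∅ := by
          ext k; simp only [Set.mem_ofPred_eq, Set.mem_empty_iff_false, iff_false]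
          exact fun hk => h ⟨k, hk⟩
        rw [this]; simp
  rw [this]
  exact (MeasurableSet.biUnion (Set.to_countable _) fun k _ => hS k).union
    (MeasurableSet.iUnion hS).compl

lemma measurable_failures (j : ℕ) : Measurable (failures j) := by
  have h : Measurable fun q : ℕ × (ℕ → Bool) => countUpTo false q.1 q.2 :=
    measurable_from_prod_countable_right fun k => measurable_countUpTo false k
  exact h.comp ((measurable_trials j).prodMk measurable_id)

/-- The transition kernel of the process: from the state `j` the chain jumps to a state with the
law of `A_j`. -/
def step {M : ℕ} (p : Cookies M) : Kernel ℕ ℕ :=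
  Kernel.ofFunOfCountable fun j => (bernoulliLaw p).map (failures j)

instance {M : ℕ} (p : Cookies M) : IsMarkovKernel (step p) :=
  ⟨fun j => Measure.isProbabilityMeasure_map (measurable_failures j).aemeasurable⟩

/-- The law, on the space of paths, of the Markov chain `Z` with `Z_0 = z` and transition kernel
`step p`. Under this law `Z_n` is the coordinate `n`. -/
def chainLaw {M : ℕ} (p : Cookies M) (z : ℕ) : Measure (ℕ → ℕ) :=
  Kernel.traj (X := fun _ => ℕ)
    (fun n => (step p).comap (fun h : (Finset.Iic n) → ℕ => h ⟨n, by simp⟩)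
      (measurable_pi_apply _)) 0 (fun _ => z)

instance {M : ℕ} (p : Cookies M) (z : ℕ) : IsProbabilityMeasure (chainLaw p z) := by
  unfold chainLaw; infer_instance

end

end CookieWalk

namespace CookieWalk

noncomputable section

/-! ### Independent Bernoulli sequences with arbitrary parameters -/

/-! The number of failures before a given success satisfies a first-trial recursion
(`integral_failLaw_succ`), and every estimate on the branching process is obtained from it by
induction.

Ergodicity: from a state `j ≥ M - 1` all cookies are used, so the mean of the next state is at most
`j - α`. For `α > 0` this Foster drift makes excursions from `0` finite in mean, and their
occupation measure, normalised, is invariant (`exists_invariant_of_drift`). All transition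
probabilities are positive; a variance argument then gives convergence and uniqueness
(`tendsto_kernelOp_iterate`).

Infinite moment: put `M = m + 1` and let `f_q(j)` be the probability that a binomial variable with
parameters `j` and `q` is at least `m + 1`. With fair coins, thinning the failures with probability
`q` turns `f_q` into a binomial tail with parameter `q' = q / (1 + q)`; if at worst all `M` cookies
give successes, one still has `P f_q ≥ f_{q'}` (`binomTail_le_integral`). Integrating against `π`,
and keeping only the jump from `0` to `m + 1`, gives `∫ (f_q - f_{q'}) dπ ≥ c q^(m+1)` with `c > 0`.
But `(f_q - f_{q'}) / q^(m+1)` is at most `j^m` and its positive part tends to `0` pointwise as `q →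
0`, so dominated convergence forbids a finite moment of order `m`.

Zero speed for `M = 2` is proved on the walk itself, without the branching process. The conditional
drift is nonnegative, so no negative speed is possible. In an excursion below the running maximum
every site above the start has already lost its first cookie, so the excursion meets at most one
cookie per site, of strength `p_2 < 1`. It reaches depth `e` with probability at least of order
`e^(-2)` and then lasts a further time at least `e` in mean; the harmonic series makes the mean
duration infinite. A truncated version of this duration serves as a potential (`excValue_drift`),
and a Chernoff bound for functionals with nonnegative drift (`IsCookieWalk.eventually_ge`) shows
that each unit gained by the maximum costs arbitrarily much time. -/

/-- The law of a sequence of independent Bernoulli variables with parameters `s`. -/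
def bernoulliSeq (s : ℕ → unitInterval) : Measure (ℕ → Bool) :=
  Measure.infinitePi fun i => bernoulliMeasure true false (s i)

instance (s : ℕ → unitInterval) : IsProbabilityMeasure (bernoulliSeq s) := by
  unfold bernoulliSeq; infer_instance

/-- The sequence of parameters without its first term. -/
def tailSeq (s : ℕ → unitInterval) : ℕ → unitInterval := fun i => s (i + 1)

/-- The sequence `b, B 0, B 1, …`. -/
def consSeq (b : Bool) (B : ℕ → Bool) : ℕ → Bool := fun n => Nat.casesOn n b B

lemma measurable_consSeq (b : Bool) : Measurable (consSeq b) := by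
  refine measurable_pi_lambda _ fun n => ?_
  cases n with
  | zero => exact measurable_const
  | succ n => exact measurable_pi_apply n

lemma consSeq_preimage_pi (b : Bool) (N : ℕ) (t : ℕ → Set Bool) :
    consSeq b ⁻¹' (Set.pi (Finset.range (N + 1)) t) =
      {B | b ∈ t 0 ∧ B ∈ Set.pi (Finset.range N) fun i => t (i + 1)} := by
  ext B
  simp only [Set.mem_preimage, Set.mem_pi, Finset.coe_range, Set.mem_Iio]
  constructor
  · intro h
    exact ⟨h 0 (by omega), fun i hi => h (i + 1) (by omega)⟩
  · rintro ⟨h0, h⟩ i hi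
    cases i with
    | zero => exact h0
    | succ i => exact h i (by omega)

lemma pi_eq_pi_range (I : Finset ℕ) (t : ℕ → Set Bool) {N : ℕ} (hN : ∀ i ∈ I, i < N) :
    Set.pi (I : Set ℕ) t =
      Set.pi (Finset.range N : Set ℕ) fun i => if i ∈ I then t i else Set.univ := by
  ext B
  simp only [Set.mem_pi, Finset.mem_coe, Finset.mem_range]
  constructor
  · intro h i _
    by_cases hi : i ∈ I
    · simpa [hi] using h i hi
    · simp [hi]
  · intro h i hi
    simpa [hi] using h i (hN i hi)

/-- Conditioning on the first trial; it suffices to compare both sides on finite cylinders. All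
later recursions come from this identity. -/
lemma bernoulliSeq_eq (s : ℕ → unitInterval) :
    bernoulliSeq s =
      unitInterval.toNNReal (s 0) • (bernoulliSeq (tailSeq s)).map (consSeq true) +
      unitInterval.toNNReal (unitInterval.symm (s 0)) •
        (bernoulliSeq (tailSeq s)).map (consSeq false) := by
  symm
  refine Measure.eq_infinitePi _ fun I t ht => ?_
  obtain ⟨N, hN⟩ : ∃ N, ∀ i ∈ I, i < N + 1 :=
    ⟨I.sup id, fun i hi => Nat.lt_succ_of_le (Finset.le_sup (f := id) hi)⟩
  set u : ℕ → Set Bool := fun i => if i ∈ I then t i else Set.univ with hu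
  have hum : ∀ i, MeasurableSet (u i) := fun i => .of_discrete
  have hprod : ∏ i ∈ I, bernoulliMeasure true false (s i) (t i) =
      ∏ i ∈ Finset.range (N + 1), bernoulliMeasure true false (s i) (u i) := by
    rw [← Finset.prod_subset (s₁ := I) (fun i hi => Finset.mem_range.2 (hN i hi))]
    · exact Finset.prod_congr rfl fun i hi => by simp [hu, hi]
    · intro i _ hi
      simp [hu, hi]
  rw [hprod, pi_eq_pi_range I t hN, Finset.prod_range_succ']
  have hpi : MeasurableSet (Set.pi (Finset.range (N + 1) : Set ℕ) u) :=
    MeasurableSet.pi (Finset.countable_toSet _) fun i _ => hum i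
  have htail : bernoulliSeq (tailSeq s) (Set.pi (Finset.range N : Set ℕ) fun i => u (i + 1)) =
      ∏ i ∈ Finset.range N, bernoulliMeasure true false (s (i + 1)) (u (i + 1)) :=
    Measure.infinitePi_pi (μ := fun i => bernoulliMeasure true false (s (i + 1)))
      (t := fun i => u (i + 1)) fun i _ => hum _
  have hcons : ∀ b, (bernoulliSeq (tailSeq s)).map (consSeq b)
      (Set.pi (Finset.range (N + 1) : Set ℕ) u) =
      (u 0).indicator 1 b *
        ∏ i ∈ Finset.range N, bernoulliMeasure true false (s (i + 1)) (u (i + 1)) := by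
    intro b
    rw [Measure.map_apply (measurable_consSeq b) hpi, consSeq_preimage_pi, ← htail]
    by_cases hb : b ∈ u 0
    · simp only [hb, true_and, Set.indicator_of_mem, Pi.one_apply, one_mul]
      rfl
    · simp [hb]
  have h0 : bernoulliMeasure true false (s 0) (u 0) =
      unitInterval.toNNReal (s 0) * (u 0).indicator 1 true +
        unitInterval.toNNReal (unitInterval.symm (s 0)) * (u 0).indicator 1 false := by
    rw [bernoulliMeasure_def, Measure.add_apply, Measure.smul_apply, Measure.smul_apply,
      Measure.dirac_apply' _ (hum 0), Measure.dirac_apply' _ (hum 0)]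
    rfl
  rw [Measure.add_apply, Measure.smul_apply, Measure.smul_apply, hcons, hcons, h0]
  simp only [ENNReal.smul_def, smul_eq_mul]
  ring

/-! ### The number of failures before a given number of successes -/

lemma countUpTo_zero (b : Bool) (B : ℕ → Bool) : countUpTo b 0 B = 0 := by simp [countUpTo]

lemma countUpTo_consSeq (b c : Bool) (k : ℕ) (B : ℕ → Bool) :
    countUpTo b (k + 1) (consSeq c B) = countUpTo b k B + if c = b then 1 else 0 := by
  simp only [countUpTo, Finset.card_filter]
  rw [Finset.sum_range_succ']
  rfl

/-- The sequence `B` contains `r` successes. -/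
def Reaches (r : ℕ) (B : ℕ → Bool) : Prop := ∃ k, countUpTo true k B = r

lemma reaches_zero (B : ℕ → Bool) : Reaches 0 B := ⟨0, countUpTo_zero _ _⟩

lemma measurableSet_reaches (r : ℕ) : MeasurableSet {B | Reaches r B} := by
  have : {B | Reaches r B} = ⋃ k, {B | countUpTo true k B = r} := by ext; simp [Reaches]
  rw [this]
  exact MeasurableSet.iUnion fun k => measurable_countUpTo true k (measurableSet_singleton _)

lemma reaches_succ_consSeq_true (r : ℕ) (B : ℕ → Bool) :
    Reaches (r + 1) (consSeq true B) ↔ Reaches r B := by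
  constructor
  · rintro ⟨k, hk⟩
    cases k with
    | zero => simp [countUpTo_zero] at hk
    | succ k => exact ⟨k, by simpa [countUpTo_consSeq] using hk⟩
  · rintro ⟨k, hk⟩
    exact ⟨k + 1, by simp [countUpTo_consSeq, hk]⟩

lemma reaches_succ_consSeq_false (r : ℕ) (B : ℕ → Bool) :
    Reaches (r + 1) (consSeq false B) ↔ Reaches (r + 1) B := by
  constructor
  · rintro ⟨k, hk⟩
    cases k with
    | zero => simp [countUpTo_zero] at hk
    | succ k => exact ⟨k, by simpa [countUpTo_consSeq] using hk⟩
  · rintro ⟨k, hk⟩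
    exact ⟨k + 1, by simp [countUpTo_consSeq, hk]⟩

/-- The number of failures before the success number `r` (with no success for `r = 0`). -/
def failuresBefore : ℕ → (ℕ → Bool) → ℕ
  | 0, _ => 0
  | j + 1, B => failures j B

lemma measurable_failuresBefore : ∀ r, Measurable (failuresBefore r)
  | 0 => measurable_const
  | j + 1 => measurable_failures j

/-- `Reaches` excludes the junk value `sInf ∅ = 0`. After the shift by one the index `0` is
admissible, which is the case where the first trial already is the required success. -/
lemma trials_consSeq {j : ℕ} {c : Bool} {B : ℕ → Bool} (h : Reaches (j + 1) (consSeq c B)) :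
    trials j (consSeq c B) =
      sInf {k | countUpTo true k B + (if c = true then 1 else 0) = j + 1} + 1 := by
  have hne : {k | 1 ≤ k ∧ countUpTo true k (consSeq c B) = j + 1}.Nonempty := by
    obtain ⟨k, hk⟩ := h
    refine ⟨k, ?_, hk⟩
    rcases Nat.eq_zero_or_pos k with rfl | h
    · simp [countUpTo_zero] at hk
    · exact h
  have h1 : 1 ≤ sInf {k | 1 ≤ k ∧ countUpTo true k (consSeq c B) = j + 1} :=
    (Nat.sInf_mem hne).1
  rw [trials, ← Nat.sInf_add h1]
  simp [countUpTo_consSeq]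

lemma failuresBefore_consSeq_true {r : ℕ} {B : ℕ → Bool} (h : Reaches r B) :
    failuresBefore (r + 1) (consSeq true B) = failuresBefore r B := by
  have ht := trials_consSeq ((reaches_succ_consSeq_true r B).2 h)
  cases r with
  | zero =>
    have : sInf {k | countUpTo true k B + (if true = true then 1 else 0) = 0 + 1} = 0 :=
      Nat.sInf_eq_zero.2 (Or.inl (by simp [countUpTo_zero]))
    rw [this] at ht
    simp [failuresBefore, failures, ht, countUpTo_consSeq, countUpTo_zero]
  | succ r =>
    have : {k | countUpTo true k B + (if true = true then 1 else 0) = r + 1 + 1} =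
        {k | 1 ≤ k ∧ countUpTo true k B = r + 1} := by
      ext k
      rcases Nat.eq_zero_or_pos k with rfl | h
      · simp [countUpTo_zero]
      · simp [Nat.succ_le_of_lt h]
    rw [this] at ht
    simp only [failuresBefore, failures, ht, countUpTo_consSeq]
    simp [trials]

lemma failuresBefore_consSeq_false {r : ℕ} {B : ℕ → Bool} (h : Reaches (r + 1) B) :
    failuresBefore (r + 1) (consSeq false B) = failuresBefore (r + 1) B + 1 := by
  have ht := trials_consSeq ((reaches_succ_consSeq_false r B).2 h)
  have : {k | countUpTo true k B + (if false = true then 1 else 0) = r + 1} =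
      {k | 1 ≤ k ∧ countUpTo true k B = r + 1} := by
    ext k
    rcases Nat.eq_zero_or_pos k with rfl | h
    · simp [countUpTo_zero]
    · simp [Nat.succ_le_of_lt h]
  rw [this] at ht
  simp only [failuresBefore, failures, ht, countUpTo_consSeq]
  simp [trials]

/-- From the index `c` on, the parameters are `1/2`. -/
def EventuallyHalf (c : ℕ) (s : ℕ → unitInterval) : Prop := ∀ i, c ≤ i → (s i : ℝ) = 1 / 2

lemma EventuallyHalf.tail {c : ℕ} {s : ℕ → unitInterval} (h : EventuallyHalf (c + 1) s) :
    EventuallyHalf c (tailSeq s) := fun i hi => h (i + 1) (by omega)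

lemma EventuallyHalf.tailSeq_eq {s : ℕ → unitInterval} (h : EventuallyHalf 0 s) :
    tailSeq s = s := by
  funext i
  exact Subtype.ext ((h (i + 1) (by omega)).trans (h i (by omega)).symm)

lemma bernoulliSeq_real_apply (s : ℕ → unitInterval) {A : Set (ℕ → Bool)} (hA : MeasurableSet A) :
    (bernoulliSeq s).real A =
      s 0 * (bernoulliSeq (tailSeq s)).real (consSeq true ⁻¹' A) +
        (1 - s 0) * (bernoulliSeq (tailSeq s)).real (consSeq false ⁻¹' A) := by
  conv_lhs => rw [bernoulliSeq_eq s]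
  rw [measureReal_add_apply, measureReal_nnreal_smul_apply, measureReal_nnreal_smul_apply,
    map_measureReal_apply (measurable_consSeq _) hA,
    map_measureReal_apply (measurable_consSeq _) hA]
  simp

/-- For fair coins the recursion reads `x = 0 / 2 + x / 2`, which forces `x = 0`. The finitely many
other trials are removed one at a time. -/
lemma bernoulliSeq_not_reaches {c : ℕ} {s : ℕ → unitInterval} (hs : EventuallyHalf c s) (r : ℕ) :
    (bernoulliSeq s).real {B | Reaches r B}ᶜ = 0 := by
  have hrec : ∀ (s : ℕ → unitInterval) (r : ℕ), (bernoulliSeq s).real {B | Reaches (r + 1) B}ᶜ =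
      s 0 * (bernoulliSeq (tailSeq s)).real {B | Reaches r B}ᶜ +
        (1 - s 0) * (bernoulliSeq (tailSeq s)).real {B | Reaches (r + 1) B}ᶜ := by
    intro s r
    rw [bernoulliSeq_real_apply s (measurableSet_reaches _).compl]
    congr 3
    · ext B; simp [reaches_succ_consSeq_true]
    · ext B; simp [reaches_succ_consSeq_false]
  have hzero : ∀ s, (bernoulliSeq s).real {B | Reaches 0 B}ᶜ = 0 := by
    intro s
    have : {B | Reaches 0 B}ᶜ = ∅ := by ext B; simp [reaches_zero]
    simp [this]
  induction c generalizing s r with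
  | zero =>
    induction r with
    | zero => exact hzero s
    | succ r ih =>
      have := hrec s r
      rw [hs.tailSeq_eq, ih, hs 0 le_rfl] at this
      linarith
  | succ c ih =>
    cases r with
    | zero => exact hzero s
    | succ r => rw [hrec, ih hs.tail, ih hs.tail]; simp

lemma ae_reaches {c : ℕ} {s : ℕ → unitInterval} (hs : EventuallyHalf c s) (r : ℕ) :
    ∀ᵐ B ∂bernoulliSeq s, Reaches r B := by
  have := bernoulliSeq_not_reaches hs r
  rwa [measureReal_eq_zero_iff] at this

lemma EventuallyHalf.weaken_tail {c : ℕ} {s : ℕ → unitInterval} (h : EventuallyHalf c s) :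
    EventuallyHalf c (tailSeq s) := fun i hi => h (i + 1) (by omega)

/-- The law of the number of failures before the success number `r`. -/
def failLaw (s : ℕ → unitInterval) (r : ℕ) : Measure ℕ := (bernoulliSeq s).map (failuresBefore r)

instance (s : ℕ → unitInterval) (r : ℕ) : IsProbabilityMeasure (failLaw s r) :=
  Measure.isProbabilityMeasure_map (measurable_failuresBefore r).aemeasurable

lemma failLaw_zero (s : ℕ → unitInterval) : failLaw s 0 = Measure.dirac 0 := by
  have : failuresBefore 0 = fun _ => 0 := by funext; rfl
  rw [failLaw, this, Measure.map_const, measure_univ, one_smul]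

lemma failLaw_succ {c : ℕ} {s : ℕ → unitInterval} (hs : EventuallyHalf c s) (r : ℕ) :
    failLaw s (r + 1) =
      unitInterval.toNNReal (s 0) • failLaw (tailSeq s) r +
      unitInterval.toNNReal (unitInterval.symm (s 0)) •
        (failLaw (tailSeq s) (r + 1)).map (· + 1) := by
  have hm := measurable_failuresBefore (r + 1)
  rw [failLaw, bernoulliSeq_eq s, Measure.map_add _ _ hm, Measure.map_smul, Measure.map_smul,
    Measure.map_map hm (measurable_consSeq _), Measure.map_map hm (measurable_consSeq _),
    failLaw, failLaw, Measure.map_map (measurable_of_countable _) hm]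
  congr 2
  · refine Measure.map_congr ?_
    filter_upwards [ae_reaches hs.weaken_tail r] with B hB
    exact failuresBefore_consSeq_true hB
  · refine Measure.map_congr ?_
    filter_upwards [ae_reaches hs.weaken_tail (r + 1)] with B hB
    exact failuresBefore_consSeq_false hB

lemma integrable_of_bounded {μ : Measure ℕ} [IsFiniteMeasure μ] {f : ℕ → ℝ} {C : ℝ}
    (hf : ∀ k, |f k| ≤ C) : Integrable f μ :=
  Integrable.of_bound (measurable_of_countable f).aestronglyMeasurable C (ae_of_all _ hf)

lemma integral_failLaw_succ {c : ℕ} {s : ℕ → unitInterval} (hs : EventuallyHalf c s) (r : ℕ)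
    {f : ℕ → ℝ} {C : ℝ} (hf : ∀ k, |f k| ≤ C) :
    ∫ k, f k ∂failLaw s (r + 1) =
      s 0 * ∫ k, f k ∂failLaw (tailSeq s) r +
        (1 - s 0) * ∫ k, f (k + 1) ∂failLaw (tailSeq s) (r + 1) := by
  have : IsProbabilityMeasure ((failLaw (tailSeq s) (r + 1)).map (· + 1)) :=
    Measure.isProbabilityMeasure_map (measurable_of_countable _).aemeasurable
  rw [failLaw_succ hs, integral_add_measure ((integrable_of_bounded hf).smul_measure_nnreal)
    ((integrable_of_bounded hf).smul_measure_nnreal), integral_smul_nnreal_measure,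
    integral_smul_nnreal_measure, integral_map (measurable_of_countable _).aemeasurable
      (measurable_of_countable f).aestronglyMeasurable]
  simp [NNReal.smul_def]

lemma integral_failLaw_succ_half {s : ℕ → unitInterval} (hs : EventuallyHalf 0 s) (r : ℕ)
    {f : ℕ → ℝ} {C : ℝ} (hf : ∀ k, |f k| ≤ C) :
    ∫ k, f k ∂failLaw s (r + 1) =
      1 / 2 * ∫ k, f k ∂failLaw s r + 1 / 2 * ∫ k, f (k + 1) ∂failLaw s (r + 1) := by
  have := integral_failLaw_succ hs r hf
  rw [hs.tailSeq_eq, hs 0 le_rfl] at this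
  linarith

lemma failLaw_real_pos {c : ℕ} {s : ℕ → unitInterval} (hs : EventuallyHalf c s)
    (h : ∀ i, (s i : ℝ) ∈ Set.Ioo 0 1) (r k : ℕ) : 0 < (failLaw s (r + 1)).real {k} := by
  have hrec : ∀ (s : ℕ → unitInterval) (_ : EventuallyHalf c s) (r k : ℕ),
      (failLaw s (r + 1)).real {k} = s 0 * (failLaw (tailSeq s) r).real {k} +
        (1 - s 0) * (failLaw (tailSeq s) (r + 1)).real ((· + 1) ⁻¹' {k}) := by
    intro s hs r k
    conv_lhs => rw [failLaw_succ hs]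
    have : IsProbabilityMeasure ((failLaw (tailSeq s) (r + 1)).map (· + 1)) :=
      Measure.isProbabilityMeasure_map (measurable_of_countable _).aemeasurable
    rw [measureReal_add_apply, measureReal_nnreal_smul_apply, measureReal_nnreal_smul_apply,
      map_measureReal_apply (measurable_of_countable _) (measurableSet_singleton _)]
    simp
  induction k generalizing s r with
  | zero =>
    induction r generalizing s with
    | zero =>
      rw [hrec s hs, failLaw_zero]
      refine add_pos_of_pos_of_nonneg (mul_pos (h 0).1 ?_)
        (mul_nonneg (sub_nonneg.2 (h 0).2.le) measureReal_nonneg)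
      simp [measureReal_def]
    | succ r ih =>
      rw [hrec s hs]
      exact add_pos_of_pos_of_nonneg (mul_pos (h 0).1 (ih hs.weaken_tail fun i => h (i + 1)))
        (mul_nonneg (sub_nonneg.2 (h 0).2.le) measureReal_nonneg)
  | succ k ih =>
    rw [hrec s hs]
    have : (· + 1) ⁻¹' {k + 1} = ({k} : Set ℕ) := by ext; simp
    rw [this]
    exact add_pos_of_nonneg_of_pos (mul_nonneg (h 0).1.le measureReal_nonneg)
      (mul_pos (sub_pos.2 (h 0).2) (ih hs.weaken_tail (fun i => h (i + 1)) r))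

/-! ### The mean number of failures -/

lemma abs_min_natCast_le (K k : ℕ) : |(min k K : ℝ)| ≤ K := by
  rw [abs_of_nonneg (by positivity)]
  exact min_le_right _ _

lemma integral_min_failLaw_succ_le {c : ℕ} {s : ℕ → unitInterval} (hs : EventuallyHalf c s)
    (K r : ℕ) :
    ∫ k, (min k K : ℝ) ∂failLaw s (r + 1) ≤
      s 0 * ∫ k, (min k K : ℝ) ∂failLaw (tailSeq s) r +
        (1 - s 0) * (∫ k, (min k K : ℝ) ∂failLaw (tailSeq s) (r + 1) + 1) := by
  have hb := abs_min_natCast_le K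
  rw [integral_failLaw_succ hs r hb]
  refine add_le_add_right (mul_le_mul_of_nonneg_left ?_ (sub_nonneg.2 (s 0).2.2)) _
  have h2 : ∫ k, (min ((k + 1 : ℕ) : ℝ) K : ℝ) ∂failLaw (tailSeq s) (r + 1) ≤
      ∫ k, ((min k K : ℝ) + 1) ∂failLaw (tailSeq s) (r + 1) := by
    refine integral_mono (integrable_of_bounded fun k => hb (k + 1))
      ((integrable_of_bounded hb).add (integrable_const _)) fun k => ?_
    have : (min ((k + 1 : ℕ) : ℝ) K : ℝ) ≤ min (k : ℝ) K + 1 := by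
      rcases min_cases (k : ℝ) K with h | h <;> push_cast <;>
        [exact (min_le_left _ _).trans (by linarith [h.1]);
          exact (min_le_right _ _).trans (by linarith [h.1])]
    exact this
  rw [integral_add (integrable_of_bounded hb) (integrable_const _)] at h2
  simpa using h2

/-- The unknown integral occurs on both sides of the recursion. Truncation at `K` makes it finite,
so that it can be solved for. -/
lemma integral_min_failLaw_half {s : ℕ → unitInterval} (hs : EventuallyHalf 0 s) (K r : ℕ) :
    ∫ k, (min k K : ℝ) ∂failLaw s r ≤ r := by
  induction r with
  | zero => simp [failLaw_zero]
  | succ r ih =>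
    have h1 := integral_min_failLaw_succ_le hs K r
    rw [hs.tailSeq_eq, hs 0 le_rfl] at h1
    push_cast
    linarith

lemma integral_min_failLaw_le_add {c : ℕ} {s : ℕ → unitInterval} (hs : EventuallyHalf c s)
    (K r : ℕ) : ∫ k, (min k K : ℝ) ∂failLaw s r ≤ r + c := by
  induction c generalizing s r with
  | zero => simpa using integral_min_failLaw_half hs K r
  | succ c ih =>
    cases r with
    | zero => simp [failLaw_zero]; positivity
    | succ r =>
      refine (integral_min_failLaw_succ_le hs K r).trans ?_
      have h3 := mul_le_mul_of_nonneg_left (ih hs.tail r) (s 0).2.1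
      have h4 := mul_le_mul_of_nonneg_left (ih hs.tail (r + 1)) (sub_nonneg.2 (s 0).2.2)
      have := (s 0).2.1
      push_cast at h4 ⊢
      linarith

/-- Trial `i` adds `1 - 2 s_i` on average to failures minus successes. The condition `c ≤ r` ensures
that the first `c` trials all take place before the success number `r`. -/
lemma integral_min_failLaw {c : ℕ} {s : ℕ → unitInterval} (hs : EventuallyHalf c s) (K : ℕ)
    {r : ℕ} (hr : c ≤ r) :
    ∫ k, (min k K : ℝ) ∂failLaw s r ≤ r - ∑ i ∈ Finset.range c, (2 * (s i : ℝ) - 1) := by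
  induction c generalizing s r with
  | zero => simpa using integral_min_failLaw_half hs K r
  | succ c ih =>
    obtain ⟨r, rfl⟩ : ∃ q, r = q + 1 := ⟨r - 1, by omega⟩
    refine (integral_min_failLaw_succ_le hs K r).trans ?_
    have h3 := mul_le_mul_of_nonneg_left (ih hs.tail (show c ≤ r by omega)) (s 0).2.1
    have h4 := mul_le_mul_of_nonneg_left (ih hs.tail (show c ≤ r + 1 by omega))
      (sub_nonneg.2 (s 0).2.2)
    rw [Finset.sum_range_succ']
    have e : ∑ i ∈ Finset.range c, (2 * (tailSeq s i : ℝ) - 1) =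
      ∑ i ∈ Finset.range c, (2 * (s (i + 1) : ℝ) - 1) := rfl
    rw [e] at h3 h4
    push_cast at h4 ⊢
    nlinarith

/-! ### Upper tails of binomial laws -/

/-- The probability that a binomial variable with parameters `j` and `q` is at least `m`. -/
def binomTail (q : ℝ) : ℕ → ℕ → ℝ
  | 0, _ => 1
  | _ + 1, 0 => 0
  | m + 1, j + 1 => q * binomTail q m j + (1 - q) * binomTail q (m + 1) j

@[simp] lemma binomTail_zero_left (q : ℝ) (j : ℕ) : binomTail q 0 j = 1 := by
  cases j <;> simp [binomTail]

@[simp] lemma binomTail_succ_zero (q : ℝ) (m : ℕ) : binomTail q (m + 1) 0 = 0 := by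
  simp [binomTail]

lemma binomTail_succ_succ (q : ℝ) (m j : ℕ) :
    binomTail q (m + 1) (j + 1) = q * binomTail q m j + (1 - q) * binomTail q (m + 1) j := by
  simp [binomTail]

lemma binomTail_mem_Icc {q : ℝ} (h0 : 0 ≤ q) (h1 : q ≤ 1) (m j : ℕ) :
    binomTail q m j ∈ Set.Icc (0 : ℝ) 1 := by
  induction j generalizing m with
  | zero => cases m <;> simp
  | succ j ih =>
    cases m with
    | zero => simp
    | succ m =>
      rw [binomTail_succ_succ]
      obtain ⟨a0, a1⟩ := ih m
      obtain ⟨b0, b1⟩ := ih (m + 1)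
      constructor <;> nlinarith

lemma binomTail_succ_le {q : ℝ} (h0 : 0 ≤ q) (h1 : q ≤ 1) (m j : ℕ) :
    binomTail q (m + 1) j ≤ binomTail q m j := by
  induction j generalizing m with
  | zero => cases m <;> simp
  | succ j ih =>
    cases m with
    | zero => simpa using (binomTail_mem_Icc h0 h1 1 (j + 1)).2
    | succ m =>
      rw [binomTail_succ_succ, binomTail_succ_succ]
      nlinarith [ih m, ih (m + 1)]

lemma binomTail_mono {q : ℝ} (h0 : 0 ≤ q) (h1 : q ≤ 1) (m : ℕ) : Monotone (binomTail q m) := by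
  refine monotone_nat_of_le_succ fun j => ?_
  cases m with
  | zero => simp
  | succ m =>
    rw [binomTail_succ_succ]
    nlinarith [binomTail_succ_le h0 h1 m j]

lemma binomTail_of_lt (q : ℝ) {m j : ℕ} (h : j < m) : binomTail q m j = 0 := by
  induction j generalizing m with
  | zero =>
    obtain ⟨m, rfl⟩ : ∃ k, m = k + 1 := ⟨m - 1, by omega⟩
    simp
  | succ j ih =>
    obtain ⟨m, rfl⟩ : ∃ k, m = k + 1 := ⟨m - 1, by omega⟩
    rw [binomTail_succ_succ, ih (by omega), ih (by omega)]
    ring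

lemma binomTail_self (q : ℝ) (m : ℕ) : binomTail q m m = q ^ m := by
  induction m with
  | zero => simp
  | succ m ih => rw [binomTail_succ_succ, ih, binomTail_of_lt q (by omega)]; ring

lemma pow_add_pow_succ_le (j m : ℕ) :
    (j : ℝ) ^ m + (j : ℝ) ^ (m + 1) ≤ ((j + 1 : ℕ) : ℝ) ^ (m + 1) := by
  have : (j : ℝ) ^ m ≤ ((j + 1 : ℕ) : ℝ) ^ m := by gcongr; simp
  calc (j : ℝ) ^ m + (j : ℝ) ^ (m + 1) = (j : ℝ) ^ m * ((j + 1 : ℕ) : ℝ) := by push_cast; ring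
    _ ≤ ((j + 1 : ℕ) : ℝ) ^ m * ((j + 1 : ℕ) : ℝ) := by gcongr
    _ = _ := by ring

/-- The difference is the probability of exactly `m` successes, at most `j.choose m * q ^ m`. -/
lemma binomTail_sub_succ_le {q : ℝ} (h0 : 0 ≤ q) (h1 : q ≤ 1) (m j : ℕ) :
    binomTail q m j - binomTail q (m + 1) j ≤ (j : ℝ) ^ m * q ^ m := by
  induction j generalizing m with
  | zero => cases m <;> simp
  | succ j ih =>
    cases m with
    | zero => simpa using (binomTail_mem_Icc h0 h1 1 (j + 1)).1
    | succ m =>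
      rw [binomTail_succ_succ, binomTail_succ_succ]
      have e1 := mul_le_mul_of_nonneg_left (ih m) h0
      have e2 := mul_le_mul_of_nonneg_left (ih (m + 1)) (sub_nonneg.2 h1)
      have e3 := mul_le_mul_of_nonneg_right (pow_add_pow_succ_le j m) (pow_nonneg h0 (m + 1))
      have e4 : 0 ≤ q * ((j : ℝ) ^ (m + 1) * q ^ (m + 1)) := by positivity
      have e5 : q * ((j : ℝ) ^ m * q ^ m) = (j : ℝ) ^ m * q ^ (m + 1) := by ring
      nlinarith

/-- Couple the first trials of the two laws: they differ with probability `q - q'`, and this matters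
only if the other `j` trials with parameter `q'` give exactly `m` successes. -/
lemma binomTail_sub_le_of_succ {q q' : ℝ} (h0 : 0 ≤ q') (h : q' ≤ q) (h1 : q ≤ 1)
    (hq : q - q' ≤ q ^ 2) (m j : ℕ) :
    binomTail q (m + 1) (j + 1) - binomTail q' (m + 1) (j + 1) ≤
      q * (binomTail q m j - binomTail q' m j) +
        (1 - q) * (binomTail q (m + 1) j - binomTail q' (m + 1) j) +
        q ^ 2 * ((j : ℝ) ^ m * q ^ m) := by
  have e1 := binomTail_sub_succ_le h0 (h.trans h1) m j
  have e2 : (j : ℝ) ^ m * q' ^ m ≤ (j : ℝ) ^ m * q ^ m := by gcongr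
  have e3 := binomTail_succ_le h0 (h.trans h1) m j
  have e4 : (q - q') * (binomTail q' m j - binomTail q' (m + 1) j) ≤
      q ^ 2 * ((j : ℝ) ^ m * q ^ m) :=
    mul_le_mul hq (e1.trans e2) (by linarith) (by positivity)
  rw [binomTail_succ_succ, binomTail_succ_succ]
  nlinarith

/-- The domination for the moment argument. What matters is the exponent `m` of `j`, rather than `m
+ 1`: the loss `1 - q` in front of the induction hypothesis pays exactly for the error term of
`binomTail_sub_le_of_succ`. -/
lemma binomTail_sub_le {q q' : ℝ} (h0 : 0 ≤ q') (h : q' ≤ q) (h1 : q ≤ 1)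
    (hq : q - q' ≤ q ^ 2) (m j : ℕ) :
    binomTail q (m + 1) j - binomTail q' (m + 1) j ≤ (j : ℝ) ^ m * q ^ (m + 1) := by
  have hq0 := h0.trans h
  induction j generalizing m with
  | zero => simp; positivity
  | succ j ih =>
    refine (binomTail_sub_le_of_succ h0 h h1 hq m j).trans ?_
    have e2 := mul_le_mul_of_nonneg_left (ih m) (sub_nonneg.2 h1)
    cases m with
    | zero => simp at e2 ⊢; nlinarith
    | succ m =>
      have e1 := mul_le_mul_of_nonneg_left (ih m) hq0
      have e3 := mul_le_mul_of_nonneg_right (pow_add_pow_succ_le j m) (pow_nonneg hq0 (m + 2))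
      have e4 : q * ((j : ℝ) ^ m * q ^ (m + 1)) = (j : ℝ) ^ m * q ^ (m + 2) := by ring
      have e5 : q ^ 2 * ((j : ℝ) ^ (m + 1) * q ^ (m + 1)) =
          q * ((j : ℝ) ^ (m + 1) * q ^ (m + 2)) := by ring
      rw [e5]
      rw [e4] at e1
      nlinarith

/-- One more power of `q` than in `binomTail_sub_le`, at the price of a constant depending on `j`:
this gives the pointwise limit `0`. -/
lemma exists_binomTail_sub_le (j m : ℕ) : ∃ D : ℝ, 0 ≤ D ∧ ∀ q q' : ℝ, 0 ≤ q' → q' ≤ q → q ≤ 1 →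
    q - q' ≤ q ^ 2 → binomTail q m j - binomTail q' m j ≤ D * q ^ (m + 1) := by
  induction j generalizing m with
  | zero =>
    refine ⟨0, le_rfl, fun q q' _ _ _ _ => ?_⟩
    cases m <;> simp
  | succ j ih =>
    cases m with
    | zero => exact ⟨0, le_rfl, fun q q' _ _ _ _ => by simp⟩
    | succ m =>
      obtain ⟨D, hD, h⟩ := ih m
      obtain ⟨D', hD', h'⟩ := ih (m + 1)
      refine ⟨D + D' + (j : ℝ) ^ m, by positivity, fun q q' h0 hqq h1 hq => ?_⟩
      have hq0 := h0.trans hqq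
      refine (binomTail_sub_le_of_succ h0 hqq h1 hq m j).trans ?_
      have e1 := mul_le_mul_of_nonneg_left (h q q' h0 hqq h1 hq) hq0
      have e2 := mul_le_mul_of_nonneg_left (h' q q' h0 hqq h1 hq) (sub_nonneg.2 h1)
      have e3 : 0 ≤ q * (D' * q ^ (m + 1 + 1)) := by positivity
      have e4 : q * (D * q ^ (m + 1)) = D * q ^ (m + 2) := by ring
      have e5 : q ^ 2 * ((j : ℝ) ^ m * q ^ m) = (j : ℝ) ^ m * q ^ (m + 2) := by ring
      rw [e5]
      nlinarith

lemma abs_binomTail_le {q : ℝ} (h0 : 0 ≤ q) (h1 : q ≤ 1) (m j : ℕ) : |binomTail q m j| ≤ 1 := by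
  obtain ⟨a, b⟩ := binomTail_mem_Icc h0 h1 m j
  rwa [abs_of_nonneg a]

/-- Keep each failure with probability `q` and ignore the trials whose failure is dropped: a
remaining trial is a kept failure with probability `(q/2) / (1/2 + q/2) = q / (1 + q)`. At least `m
+ 1` kept failures precede the success number `r` exactly when the first `r + m` remaining trials
contain `m + 1` of them. -/
lemma integral_binomTail_half {s : ℕ → unitInterval} (hs : EventuallyHalf 0 s) {q : ℝ}
    (h0 : 0 ≤ q) (h1 : q ≤ 1) (m r : ℕ) :
    ∫ k, binomTail q (m + 1) k ∂failLaw s r = binomTail (q / (1 + q)) (m + 1) (r + m) := by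
  have hq : (1 + q) ≠ 0 := by positivity
  induction r generalizing m with
  | zero => rw [binomTail_of_lt _ (by omega)]; simp [failLaw_zero]
  | succ r ihr =>
    have key : ∀ m, (∫ k, binomTail q m k ∂failLaw s (r + 1) =
        binomTail (q / (1 + q)) m (r + m)) →
        ∫ k, binomTail q (m + 1) k ∂failLaw s (r + 1) =
          binomTail (q / (1 + q)) (m + 1) (r + 1 + m) := by
      intro m hm
      have h := integral_failLaw_succ_half hs r (abs_binomTail_le h0 h1 (m + 1))
      simp only [binomTail_succ_succ] at h
      rw [integral_add ((integrable_of_bounded (abs_binomTail_le h0 h1 m)).const_mul _)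
        ((integrable_of_bounded (abs_binomTail_le h0 h1 (m + 1))).const_mul _),
        integral_const_mul, integral_const_mul, hm, ihr m] at h
      rw [show r + 1 + m = r + m + 1 by ring, binomTail_succ_succ]
      field_simp
      linarith
    induction m with
    | zero => exact key 0 (by simp)
    | succ m ihm => exact key (m + 1) (by rw [ihm]; congr 1; ring)

/-- Among the outcomes of the first `c` trials, all successes is the worst one, and it leaves `r -
c` successes to wait for. If `r ≤ c`, the truncated subtraction makes the left side `0`. -/
lemma binomTail_le_integral {c : ℕ} {s : ℕ → unitInterval} (hs : EventuallyHalf c s) {q : ℝ}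
    (h0 : 0 ≤ q) (h1 : q ≤ 1) (m r : ℕ) :
    binomTail (q / (1 + q)) (m + 1) (r - c + m) ≤ ∫ k, binomTail q (m + 1) k ∂failLaw s r := by
  have hq0 : 0 ≤ q / (1 + q) := by positivity
  have hq1 : q / (1 + q) ≤ 1 := by rw [div_le_one (by positivity)]; linarith
  induction c generalizing s r with
  | zero => exact (integral_binomTail_half hs h0 h1 m r).ge
  | succ c ih =>
    cases r with
    | zero =>
      rw [binomTail_of_lt _ (by omega)]
      exact integral_nonneg fun k => (binomTail_mem_Icc h0 h1 _ _).1
    | succ r =>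
      rw [integral_failLaw_succ hs r (abs_binomTail_le h0 h1 (m + 1))]
      have e1 := ih hs.tail r
      have e2 := ih hs.tail (r + 1)
      have e3 : ∫ k, binomTail q (m + 1) k ∂failLaw (tailSeq s) (r + 1) ≤
          ∫ k, binomTail q (m + 1) (k + 1) ∂failLaw (tailSeq s) (r + 1) :=
        integral_mono (integrable_of_bounded (abs_binomTail_le h0 h1 (m + 1)))
          (integrable_of_bounded fun k => abs_binomTail_le h0 h1 (m + 1) (k + 1))
          fun k => binomTail_mono h0 h1 _ (Nat.le_succ k)
      have e4 := binomTail_mono hq0 hq1 (m + 1) (show r - c + m ≤ r + 1 - c + m by omega)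
      rw [show r + 1 - (c + 1) = r - c by omega]
      have := (s 0).2.1
      have := (s 0).2.2
      have f1 := mul_le_mul_of_nonneg_left e1 (s 0).2.1
      have f2 := mul_le_mul_of_nonneg_left (e4.trans (e2.trans e3)) (sub_nonneg.2 (s 0).2.2)
      linarith

/-! ### The transition probabilities of the branching process -/

lemma eventuallyHalf_strength {M : ℕ} (p : Cookies M) : EventuallyHalf M (strength p) := by
  intro i hi
  simp [strength, Nat.not_lt.2 hi]

lemma strength_mem_Ioo {M : ℕ} (p : Cookies M) (i : ℕ) : (strength p i : ℝ) ∈ Set.Ioo 0 1 := by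
  unfold strength
  split_ifs with h
  · exact ⟨lt_of_lt_of_le (by norm_num) (p ⟨i, h⟩).2.1, (p ⟨i, h⟩).2.2⟩
  · constructor <;> norm_num

lemma step_apply {M : ℕ} (p : Cookies M) (j : ℕ) : step p j = failLaw (strength p) (j + 1) := rfl

lemma step_real_pos {M : ℕ} (p : Cookies M) (j k : ℕ) : 0 < (step p j).real {k} :=
  failLaw_real_pos (eventuallyHalf_strength p) (strength_mem_Ioo p) j k

lemma lintegral_step_le_of_integral_min_le {μ : Measure ℕ} [IsProbabilityMeasure μ] {b : ℝ}
    (h : ∀ K : ℕ, ∫ k, (min k K : ℝ) ∂μ ≤ b) : ∫⁻ k, (k : ℝ≥0∞) ∂μ ≤ ENNReal.ofReal b := by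
  have hsup : ∀ k : ℕ, (k : ℝ≥0∞) = ⨆ K : ℕ, ENNReal.ofReal (min (k : ℝ) K) := by
    intro k
    refine le_antisymm (le_iSup_of_le k (by simp)) (iSup_le fun K => ?_)
    calc ENNReal.ofReal (min (k : ℝ) K) ≤ ENNReal.ofReal k :=
          ENNReal.ofReal_le_ofReal (min_le_left _ _)
      _ = k := by simp
  simp_rw [hsup]
  rw [lintegral_iSup (fun _ => measurable_of_countable _)]
  · refine iSup_le fun K => ?_
    rw [← ofReal_integral_eq_lintegral_ofReal]
    · exact ENNReal.ofReal_le_ofReal (h K)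
    · refine integrable_of_bounded (C := K) fun k => ?_
      rw [abs_of_nonneg (by positivity)]
      exact min_le_right _ _
    · exact ae_of_all _ fun k => by positivity
  · intro K L hKL k
    exact ENNReal.ofReal_le_ofReal (min_le_min_left _ (by exact_mod_cast hKL))

lemma sum_strength {M : ℕ} (p : Cookies M) :
    ∑ i ∈ Finset.range M, (2 * (strength p i : ℝ) - 1) = alpha p + 1 := by
  rw [Finset.sum_range]
  simp [alpha, strength]

lemma lintegral_step_lt_top {M : ℕ} (p : Cookies M) (j : ℕ) :
    ∫⁻ k, (k : ℝ≥0∞) ∂step p j < ⊤ :=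
  (lintegral_step_le_of_integral_min_le fun K =>
    integral_min_failLaw_le_add (eventuallyHalf_strength p) K (j + 1)).trans_lt
      ENNReal.ofReal_lt_top

lemma lintegral_step_le {M : ℕ} (p : Cookies M) {j : ℕ} (hj : M ≤ j + 1) :
    ∫⁻ k, (k : ℝ≥0∞) ∂step p j ≤ ENNReal.ofReal (j - alpha p) := by
  refine lintegral_step_le_of_integral_min_le fun K => ?_
  rw [step_apply]
  refine (integral_min_failLaw (eventuallyHalf_strength p) K hj).trans ?_
  rw [sum_strength]
  push_cast
  linarith

/-! ### Markov chains on `ℕ` with positive transition probabilities -/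

/-- The measures of the successive steps of the excursion from `0`, killed at its return to `0`. -/
def excursionLaw (κ : Kernel ℕ ℕ) : ℕ → Measure ℕ
  | 0 => Measure.dirac 0
  | n + 1 => ((excursionLaw κ n).bind κ).restrict {0}ᶜ

lemma lintegral_excursionLaw_succ (κ : Kernel ℕ ℕ) (n : ℕ) (f : ℕ → ℝ≥0∞) :
    ∫⁻ k, f k ∂excursionLaw κ (n + 1) =
      ∫⁻ i, ∫⁻ k in {0}ᶜ, f k ∂κ i ∂excursionLaw κ n := by
  have hm : MeasurableSet ({0}ᶜ : Set ℕ) := .of_discrete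
  rw [excursionLaw, ← lintegral_indicator hm, Measure.lintegral_bind κ.measurable.aemeasurable
    (measurable_of_countable _).aemeasurable]
  simp_rw [lintegral_indicator hm]

lemma excursionLaw_succ_zero (κ : Kernel ℕ ℕ) (n : ℕ) : excursionLaw κ (n + 1) {0} = 0 := by
  rw [excursionLaw, Measure.restrict_apply (measurableSet_singleton _)]
  simp

/-- Off `0` the function `V` loses at least one unit per step in mean, so it bounds the expected
remaining length of the excursion. -/
lemma sum_excursionLaw_le (κ : Kernel ℕ ℕ) {V : ℕ → ℝ≥0∞}
    (hV : ∀ i, i ≠ 0 → ∫⁻ k in {0}ᶜ, V k ∂κ i + 1 ≤ V i) (n : ℕ) :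
    ∑ m ∈ Finset.range n, excursionLaw κ (m + 1) Set.univ +
      ∫⁻ k, V k ∂excursionLaw κ (n + 1) ≤ ∫⁻ k, V k ∂κ 0 := by
  induction n with
  | zero =>
    rw [lintegral_excursionLaw_succ, excursionLaw, lintegral_dirac]
    simpa using setLIntegral_le_lintegral _ _
  | succ n ih =>
    refine le_trans ?_ ih
    rw [Finset.sum_range_succ, add_assoc]
    refine add_le_add_right ?_ _
    rw [lintegral_excursionLaw_succ κ (n + 1), ← lintegral_one,
      ← lintegral_add_left (measurable_of_countable _)]
    refine lintegral_mono_ae ?_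
    have h0 : ∀ᵐ i ∂excursionLaw κ (n + 1), i ≠ 0 := by
      rw [ae_iff]
      simpa using excursionLaw_succ_zero κ n
    filter_upwards [h0] with i hi
    rw [add_comm]
    exact hV i hi

lemma exists_invariant (κ : Kernel ℕ ℕ) [IsMarkovKernel κ] {V : ℕ → ℝ≥0∞}
    (hV : ∀ i, i ≠ 0 → ∫⁻ k in {0}ᶜ, V k ∂κ i + 1 ≤ V i) (hV0 : ∫⁻ k, V k ∂κ 0 ≠ ⊤) :
    ∃ π : Measure ℕ, IsProbabilityMeasure π ∧ κ.Invariant π := by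
  set ν : Measure ℕ := Measure.sum (excursionLaw κ) with hν
  have hmass : ν Set.univ = 1 + ∑' n, excursionLaw κ (n + 1) Set.univ := by
    rw [hν, Measure.sum_apply _ .univ, tsum_eq_zero_add' ENNReal.summable]
    simp [excursionLaw]
  have hfin : ν Set.univ ≠ ⊤ := by
    rw [hmass]
    refine ENNReal.add_ne_top.2 ⟨ENNReal.one_ne_top, ne_top_of_le_ne_top hV0 ?_⟩
    rw [ENNReal.tsum_eq_iSup_nat]
    exact iSup_le fun n => le_self_add.trans (sum_excursionLaw_le κ hV n)
  have hne : ν Set.univ ≠ 0 := by rw [hmass]; simp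
  have hfin' : IsFiniteMeasure ν := ⟨lt_top_iff_ne_top.2 hfin⟩
  have hbind : ∀ A : Set ℕ, (ν.bind κ) A = ∑' n, ((excursionLaw κ n).bind κ) A := by
    intro A
    rw [Measure.bind_apply .of_discrete κ.measurable.aemeasurable, hν, lintegral_sum_measure]
    simp_rw [Measure.bind_apply (MeasurableSet.of_discrete (s := A)) κ.measurable.aemeasurable]
  have hoff : ∀ A : Set ℕ, 0 ∉ A → (ν.bind κ) A = ν A := by
    intro A hA
    rw [hbind, hν, Measure.sum_apply _ .of_discrete,
      tsum_eq_zero_add' (f := fun n => excursionLaw κ n A) ENNReal.summable]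
    have : excursionLaw κ 0 A = 0 := by simp [excursionLaw, hA]
    rw [this, zero_add]
    refine tsum_congr fun n => ?_
    rw [excursionLaw, Measure.restrict_apply .of_discrete, Set.inter_eq_left.2]
    intro k hk
    simp only [Set.mem_compl_iff, Set.mem_singleton_iff]
    rintro rfl
    exact hA hk
  have huniv : (ν.bind κ) Set.univ = ν Set.univ := by
    rw [Measure.bind_apply .univ κ.measurable.aemeasurable]
    simp
  -- Off `0`, invariance is a shift of the index in the sum; at `0` it follows because the total
  -- mass is finite and preserved.
  have hzero : (ν.bind κ) {0} = ν {0} := by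
    have h1 := measure_add_measure_compl (μ := ν) (measurableSet_singleton (0 : ℕ))
    have h2 := measure_add_measure_compl (μ := ν.bind κ) (measurableSet_singleton (0 : ℕ))
    rw [huniv, ← h1, hoff {0}ᶜ (by simp)] at h2
    exact (ENNReal.add_left_inj (measure_ne_top ν _)).1 h2
  have hinv : ν.bind κ = ν := by
    refine Measure.ext_of_singleton fun k => ?_
    rcases eq_or_ne k 0 with rfl | hk
    · exact hzero
    · exact hoff {k} (by simpa using hk.symm)
  refine ⟨(ν Set.univ)⁻¹ • ν, ⟨?_⟩, ?_⟩
  · rw [Measure.smul_apply, smul_eq_mul, ENNReal.inv_mul_cancel hne hfin]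
  · rw [Kernel.Invariant, Measure.bind_smul, hinv]

lemma exists_invariant_of_drift (κ : Kernel ℕ ℕ) [IsMarkovKernel κ] (hpos : ∀ i, κ i {0} ≠ 0)
    (hfin : ∀ i, ∫⁻ k, (k : ℝ≥0∞) ∂κ i < ⊤) {a : ℝ} (ha : 0 < a) {m : ℕ}
    (hdrift : ∀ i, m ≤ i → ∫⁻ k, (k : ℝ≥0∞) ∂κ i ≤ ENNReal.ofReal (i - a)) :
    ∃ π : Measure ℕ, IsProbabilityMeasure π ∧ κ.Invariant π := by
  set A : ℝ≥0∞ := ENNReal.ofReal a⁻¹ with hA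
  set L : ℕ → ℝ≥0∞ := fun i => ∫⁻ k, (k : ℝ≥0∞) ∂κ i with hL
  -- Beyond `N` the drift applies and `i - a` is nonnegative, so `ENNReal.ofReal` does not truncate
  -- it.
  set N : ℕ := max m ⌈a⌉₊ with hN
  -- In the finitely many states below `N`, the loss comes from killing: a return to `0`, of
  -- positive probability, removes the constant `B`, which is taken large enough to cover the rest.
  set B : ℝ≥0∞ := ∑ i ∈ Finset.range N, (A * L i + 1) / κ i {0} with hB
  have hterm : ∀ i, (A * L i + 1) / κ i {0} ≠ ⊤ := fun i =>
    ENNReal.div_ne_top (ENNReal.add_ne_top.2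
      ⟨ENNReal.mul_ne_top ENNReal.ofReal_ne_top (hfin i).ne, ENNReal.one_ne_top⟩) (hpos i)
  have hBfin : B ≠ ⊤ := ENNReal.sum_ne_top.2 fun i _ => hterm i
  have hint : ∀ (μ : Measure ℕ), ∫⁻ k, (A * (k : ℝ≥0∞) + B) ∂μ =
      A * ∫⁻ k, (k : ℝ≥0∞) ∂μ + B * μ Set.univ := by
    intro μ
    rw [lintegral_add_right _ measurable_const, lintegral_const_mul _ (measurable_of_countable _),
      lintegral_const]
  refine exists_invariant κ (V := fun k => A * k + B) (fun i _ => ?_) ?_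
  · rw [hint, Measure.restrict_apply_univ]
    have hle : ∫⁻ k in {0}ᶜ, (k : ℝ≥0∞) ∂κ i ≤ L i := setLIntegral_le_lintegral _ _
    have hsum : κ i {0} + κ i {0}ᶜ = 1 := by
      rw [measure_add_measure_compl (measurableSet_singleton _), measure_univ]
    rcases lt_or_ge i N with hi | hi
    · have h1 : A * L i + 1 ≤ B * κ i {0} := by
        calc A * L i + 1 = (A * L i + 1) / κ i {0} * κ i {0} :=
              (ENNReal.div_mul_cancel (hpos i) (measure_ne_top _ _)).symm
          _ ≤ B * κ i {0} := by
              gcongr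
              exact Finset.single_le_sum (f := fun i => (A * L i + 1) / κ i {0})
                (fun _ _ => zero_le) (Finset.mem_range.2 hi)
      calc A * ∫⁻ k in {0}ᶜ, (k : ℝ≥0∞) ∂κ i + B * κ i {0}ᶜ + 1
          ≤ A * L i + B * κ i {0}ᶜ + 1 := by gcongr
        _ = (A * L i + 1) + B * κ i {0}ᶜ := by ring
        _ ≤ B * κ i {0} + B * κ i {0}ᶜ := by gcongr
        _ = B := by rw [← mul_add, hsum, mul_one]
        _ ≤ A * i + B := le_add_self
    · have hai : a ≤ i := (Nat.le_ceil a).trans (by exact_mod_cast (le_max_right m _).trans hi)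
      have h1 : A * L i + 1 ≤ A * i := by
        calc A * L i + 1 ≤ A * ENNReal.ofReal (i - a) + 1 := by
              gcongr; exact hdrift i ((le_max_left _ _).trans hi)
          _ = ENNReal.ofReal (a⁻¹ * (i - a) + 1) := by
              rw [hA, ← ENNReal.ofReal_mul (by positivity),
                ENNReal.ofReal_add (mul_nonneg (by positivity) (sub_nonneg.2 hai)) zero_le_one,
                ENNReal.ofReal_one]
          _ = ENNReal.ofReal (a⁻¹ * i) := by congr 1; field_simp; ring
          _ = A * i := by rw [hA, ENNReal.ofReal_mul (by positivity), ENNReal.ofReal_natCast]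
      calc A * ∫⁻ k in {0}ᶜ, (k : ℝ≥0∞) ∂κ i + B * κ i {0}ᶜ + 1
          ≤ A * L i + B * 1 + 1 := by gcongr; exact prob_le_one
        _ = (A * L i + 1) + B := by ring
        _ ≤ A * i + B := by gcongr
  · rw [hint, measure_univ, mul_one]
    exact ENNReal.add_ne_top.2
      ⟨ENNReal.mul_ne_top ENNReal.ofReal_ne_top (hfin 0).ne, hBfin⟩

/-- The action of a kernel on functions. -/
def kernelOp (κ : Kernel ℕ ℕ) (f : ℕ → ℝ) : ℕ → ℝ := fun i => ∫ k, f k ∂κ i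

lemma abs_integral_le_of_bounded {μ : Measure ℕ} [IsProbabilityMeasure μ] {f : ℕ → ℝ} {C : ℝ}
    (hf : ∀ k, |f k| ≤ C) : |∫ k, f k ∂μ| ≤ C := by
  simpa using norm_integral_le_of_norm_le_const (μ := μ) (f := f) (C := C) (ae_of_all _ hf)

lemma abs_kernelOp_iterate_le (κ : Kernel ℕ ℕ) [IsMarkovKernel κ] {f : ℕ → ℝ} {C : ℝ}
    (hf : ∀ k, |f k| ≤ C) (n : ℕ) : ∀ k, |(kernelOp κ)^[n] f k| ≤ C := by
  induction n with
  | zero => exact hf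
  | succ n ih =>
    intro k
    rw [Function.iterate_succ_apply']
    exact abs_integral_le_of_bounded ih

lemma integral_bind_of_bounded (κ : Kernel ℕ ℕ) [IsMarkovKernel κ] (μ : Measure ℕ)
    [IsProbabilityMeasure μ] {f : ℕ → ℝ} {C : ℝ} (hf : ∀ k, |f k| ≤ C) :
    ∫ k, f k ∂(μ.bind κ) = ∫ i, kernelOp κ f i ∂μ := by
  have : IsProbabilityMeasure ((κ ∘ₖ Kernel.const Unit μ) ()) := inferInstance
  have h := Kernel.integral_comp (κ := Kernel.const Unit μ) (η := κ) (a := ())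
    (integrable_of_bounded hf)
  rwa [Kernel.comp_apply, Kernel.const_apply] at h

lemma integral_kernelOp {κ : Kernel ℕ ℕ} [IsMarkovKernel κ] {π : Measure ℕ}
    [IsProbabilityMeasure π] (hπ : κ.Invariant π) {f : ℕ → ℝ} {C : ℝ} (hf : ∀ k, |f k| ≤ C) :
    ∫ i, kernelOp κ f i ∂π = ∫ k, f k ∂π := by
  rw [← integral_bind_of_bounded κ π hf, hπ]

lemma mul_le_integral_of_nonneg {μ : Measure ℕ} {f : ℕ → ℝ} (h0 : ∀ k, 0 ≤ f k)
    (hf : Integrable f μ) (k : ℕ) : μ.real {k} * f k ≤ ∫ i, f i ∂μ := by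
  calc μ.real {k} * f k = ∫ i in {k}, f i ∂μ := by rw [integral_singleton]; simp
    _ ≤ ∫ i, f i ∂μ := setIntegral_le_integral hf (ae_of_all _ h0)

lemma integral_sub_mean_sq (μ : Measure ℕ) [IsProbabilityMeasure μ] {f : ℕ → ℝ} {C : ℝ}
    (hf : ∀ k, |f k| ≤ C) :
    ∫ k, (f k - ∫ l, f l ∂μ) ^ 2 ∂μ = ∫ k, f k ^ 2 ∂μ - (∫ l, f l ∂μ) ^ 2 := by
  set m := ∫ l, f l ∂μ
  have hf2 : ∀ k, |f k ^ 2| ≤ C ^ 2 := fun k => by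
    rw [abs_pow]; exact pow_le_pow_left₀ (abs_nonneg _) (hf k) 2
  have e : ∀ k, (f k - m) ^ 2 = f k ^ 2 - (2 * m) * f k + m ^ 2 := fun k => by ring
  simp_rw [e]
  have hi : Integrable (fun k => f k ^ 2 - (2 * m) * f k) μ :=
    (integrable_of_bounded hf2).sub ((integrable_of_bounded hf).const_mul _)
  rw [integral_add hi (integrable_const _), integral_sub (integrable_of_bounded hf2)
      ((integrable_of_bounded hf).const_mul _), integral_const_mul]
  simp only [integral_const, probReal_univ, smul_eq_mul, one_mul]
  change _ - 2 * m * m + _ = _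
  ring

/-- The `π`-mean of the one-step variances of the iterates telescopes along the nonincreasing
sequence `∫ F_n ^ 2 dπ`, hence tends to `0`. Take `i` charged by `π`: since `κ i` charges every `k`,
each `F_n k` gets close to the mean `F_{n+1} i`, which does not depend on `k`. -/
lemma tendsto_kernelOp_iterate_sub {κ : Kernel ℕ ℕ} [IsMarkovKernel κ]
    (hpos : ∀ i k, 0 < (κ i).real {k}) {π : Measure ℕ} [IsProbabilityMeasure π]
    (hπ : κ.Invariant π) {f : ℕ → ℝ} {C : ℝ} (hf : ∀ k, |f k| ≤ C) (k l : ℕ) :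
    Tendsto (fun n => (kernelOp κ)^[n] f k - (kernelOp κ)^[n] f l) atTop (𝓝 0) := by
  set F : ℕ → ℕ → ℝ := fun n => (kernelOp κ)^[n] f with hF
  have hFb : ∀ n k, |F n k| ≤ C := abs_kernelOp_iterate_le κ hf
  have hFs : ∀ n i, F (n + 1) i = ∫ k, F n k ∂κ i := fun n i => by
    simp only [hF, Function.iterate_succ_apply']; rfl
  have hF2 : ∀ n k, |F n k ^ 2| ≤ C ^ 2 := fun n k => by
    rw [abs_pow]; exact pow_le_pow_left₀ (abs_nonneg _) (hFb n k) 2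
  set D : ℕ → ℕ → ℝ := fun n i => ∫ k, (F n k - F (n + 1) i) ^ 2 ∂κ i with hD
  have hDeq : ∀ n i, D n i = kernelOp κ (fun k => F n k ^ 2) i - F (n + 1) i ^ 2 := by
    intro n i
    simp only [hD, hFs]
    exact integral_sub_mean_sq (κ i) (hFb n)
  have hD0 : ∀ n i, 0 ≤ D n i := fun n i => integral_nonneg fun k => sq_nonneg _
  set u : ℕ → ℝ := fun n => ∫ k, F n k ^ 2 ∂π with hu
  have hKb : ∀ n i, |kernelOp κ (fun k => F n k ^ 2) i| ≤ C ^ 2 := fun n i =>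
    abs_integral_le_of_bounded (hF2 n)
  have hDint : ∀ n, Integrable (D n) π := fun n => by
    rw [show D n = fun i => kernelOp κ (fun k => F n k ^ 2) i - F (n + 1) i ^ 2 from
      funext (hDeq n)]
    exact (integrable_of_bounded (hKb n)).sub (integrable_of_bounded (hF2 (n + 1)))
  have hDu : ∀ n, ∫ i, D n i ∂π = u n - u (n + 1) := by
    intro n
    simp_rw [hDeq]
    rw [integral_sub (integrable_of_bounded (hKb n)) (integrable_of_bounded (hF2 (n + 1))),
      integral_kernelOp hπ (hF2 n)]
  have hanti : Antitone u := antitone_nat_of_succ_le fun n => by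
    have := integral_nonneg (μ := π) (f := D n) (hD0 n)
    rw [hDu] at this
    linarith
  have hubdd : BddBelow (Set.range u) := ⟨0, by
    rintro _ ⟨n, rfl⟩
    exact integral_nonneg fun k => sq_nonneg _⟩
  have hulim := tendsto_atTop_ciInf hanti hubdd
  have hDlim : Tendsto (fun n => ∫ i, D n i ∂π) atTop (𝓝 0) := by
    simp_rw [hDu]
    simpa using hulim.sub (hulim.comp (tendsto_add_atTop_nat 1))
  obtain ⟨i, hi⟩ : ∃ i, 0 < π.real {i} := by
    by_contra! h
    have : π = 0 := Measure.ext_of_singleton fun i => by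
      have := le_antisymm (h i) measureReal_nonneg
      rw [measureReal_eq_zero_iff] at this
      simpa using this
    exact IsProbabilityMeasure.ne_zero π this
  have hsingle : ∀ k, Tendsto (fun n => F n k - F (n + 1) i) atTop (𝓝 0) := by
    intro k
    have hc : 0 < π.real {i} * (κ i).real {k} := mul_pos hi (hpos i k)
    have hle : ∀ n, (F n k - F (n + 1) i) ^ 2 ≤
        (π.real {i} * (κ i).real {k})⁻¹ * ∫ i, D n i ∂π := by
      intro n
      have hb : ∀ k, |(F n k - F (n + 1) i) ^ 2| ≤ (C + C) ^ 2 := fun k => by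
        rw [abs_pow]
        exact pow_le_pow_left₀ (abs_nonneg _)
          ((abs_sub _ _).trans (add_le_add (hFb n k) (hFb (n + 1) i))) 2
      have h1 : (κ i).real {k} * (F n k - F (n + 1) i) ^ 2 ≤ D n i :=
        mul_le_integral_of_nonneg (fun k => sq_nonneg _) (integrable_of_bounded hb) k
      have h2 := mul_le_integral_of_nonneg (hD0 n) (hDint n) i
      rw [inv_mul_eq_div, le_div_iff₀ hc]
      calc (F n k - F (n + 1) i) ^ 2 * (π.real {i} * (κ i).real {k})
          = π.real {i} * ((κ i).real {k} * (F n k - F (n + 1) i) ^ 2) := by ring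
        _ ≤ π.real {i} * D n i := by gcongr
        _ ≤ _ := h2
    have hsq : Tendsto (fun n => (F n k - F (n + 1) i) ^ 2) atTop (𝓝 0) :=
      squeeze_zero (fun n => sq_nonneg _) hle (by simpa using hDlim.const_mul _)
    have habs := (Real.continuous_sqrt.tendsto 0).comp hsq
    rw [Real.sqrt_zero] at habs
    refine (tendsto_zero_iff_abs_tendsto_zero _).2 (habs.congr fun n => ?_)
    simp [Real.sqrt_sq_eq_abs]
  simpa using (hsingle k).sub (hsingle l)

lemma tendsto_kernelOp_iterate {κ : Kernel ℕ ℕ} [IsMarkovKernel κ]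
    (hpos : ∀ i k, 0 < (κ i).real {k}) {π : Measure ℕ} [IsProbabilityMeasure π]
    (hπ : κ.Invariant π) {f : ℕ → ℝ} {C : ℝ} (hf : ∀ k, |f k| ≤ C) (z : ℕ) :
    Tendsto (fun n => (kernelOp κ)^[n] f z) atTop (𝓝 (∫ k, f k ∂π)) := by
  have hFb := abs_kernelOp_iterate_le κ hf
  have hmean : ∀ n, ∫ k, (kernelOp κ)^[n] f k ∂π = ∫ k, f k ∂π := by
    intro n
    induction n with
    | zero => rfl
    | succ n ih =>
      simp_rw [Function.iterate_succ_apply']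
      rw [integral_kernelOp hπ (hFb n), ih]
  have hlim : Tendsto (fun n => ∫ k, ((kernelOp κ)^[n] f z - (kernelOp κ)^[n] f k) ∂π) atTop
      (𝓝 (∫ _, 0 ∂π)) := by
    refine tendsto_integral_of_dominated_convergence (fun _ => C + C)
      (fun n => (measurable_of_countable _).aestronglyMeasurable) (integrable_const _)
      (fun n => ae_of_all _ fun k => ?_)
      (ae_of_all _ fun k => tendsto_kernelOp_iterate_sub hpos hπ hf z k)
    exact (abs_sub _ _).trans (add_le_add (hFb n z) (hFb n k))
  have he : ∀ n, ∫ k, ((kernelOp κ)^[n] f z - (kernelOp κ)^[n] f k) ∂π =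
      (kernelOp κ)^[n] f z - ∫ k, f k ∂π := by
    intro n
    rw [integral_sub (integrable_const _) (integrable_of_bounded (hFb n)), hmean]
    simp
  simp_rw [he] at hlim
  simpa using hlim.add_const (∫ k, f k ∂π)

lemma eq_of_invariant {κ : Kernel ℕ ℕ} [IsMarkovKernel κ] (hpos : ∀ i k, 0 < (κ i).real {k})
    {π π' : Measure ℕ} [IsProbabilityMeasure π] [IsProbabilityMeasure π']
    (hπ : κ.Invariant π) (hπ' : κ.Invariant π') : π' = π := by
  refine Measure.ext_of_singleton fun k => ?_
  have hf : ∀ l, |({k} : Set ℕ).indicator (1 : ℕ → ℝ) l| ≤ 1 := fun l => by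
    by_cases h : l ∈ ({k} : Set ℕ) <;> simp [h]
  have := tendsto_nhds_unique (tendsto_kernelOp_iterate hpos hπ' hf 0)
    (tendsto_kernelOp_iterate hpos hπ hf 0)
  rw [integral_indicator_one (measurableSet_singleton _),
    integral_indicator_one (measurableSet_singleton _)] at this
  exact (measureReal_eq_measureReal_iff).1 this

lemma invariant_real_pos {κ : Kernel ℕ ℕ} [IsMarkovKernel κ] (hpos : ∀ i k, 0 < (κ i).real {k})
    {π : Measure ℕ} [IsProbabilityMeasure π] (hπ : κ.Invariant π) (k : ℕ) : 0 < π.real {k} := by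
  refine measureReal_nonneg.lt_of_ne' fun h => ?_
  rw [measureReal_eq_zero_iff] at h
  conv at h => lhs; rw [← hπ]
  rw [Measure.bind_apply (measurableSet_singleton _) κ.measurable.aemeasurable,
    lintegral_eq_zero_iff (measurable_of_countable _)] at h
  obtain ⟨i, hi⟩ := h.exists
  have := hpos i k
  simp [measureReal_def, hi] at this

/-! ### The infinite moment -/

lemma lintegral_pow_eq_top {m : ℕ} (p : Cookies (m + 1)) {π : Measure ℕ} [IsProbabilityMeasure π]
    (hπ : (step p).Invariant π) : ∫⁻ k, (k : ℝ≥0∞) ^ m ∂π = ⊤ := by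
  by_contra hfin
  have hint : Integrable (fun k : ℕ => (k : ℝ) ^ m) π := by
    refine ⟨(measurable_of_countable _).aestronglyMeasurable, ?_⟩
    rw [hasFiniteIntegral_iff_ofReal (ae_of_all _ fun k => by positivity)]
    refine lt_of_le_of_lt (lintegral_mono fun k => ?_) (lt_top_iff_ne_top.2 hfin)
    rw [ENNReal.ofReal_pow (by positivity), ENNReal.ofReal_natCast]
  set q : ℕ → ℝ := fun n => 1 / ((n : ℝ) + 1) with hq
  have hq0 : ∀ n, 0 < q n := fun n => by simp only [hq]; positivity
  have hq1 : ∀ n, q n ≤ 1 := fun n => by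
    simp only [hq]
    rw [div_le_one (by positivity)]
    linarith [(Nat.cast_nonneg n : (0 : ℝ) ≤ n)]
  set q' : ℕ → ℝ := fun n => q n / (1 + q n) with hq'
  have hq'0 : ∀ n, 0 ≤ q' n := fun n => by have := hq0 n; simp only [hq']; positivity
  have hq'q : ∀ n, q' n ≤ q n := fun n => div_le_self (hq0 n).le (by linarith [hq0 n])
  have hqq' : ∀ n, q n - q' n ≤ q n ^ 2 := fun n => by
    have h0 := hq0 n
    have : q n - q' n = q n ^ 2 / (1 + q n) := by
      simp only [hq']; field_simp; ring
    rw [this]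
    exact div_le_self (by positivity) (by linarith)
  -- The maximum with `0` turns the upper bounds into bounds on the norm, so that monotonicity of
  -- the tail in `q` is not needed.
  set G : ℕ → ℕ → ℝ := fun n j => max 0
    ((binomTail (q n) (m + 1) j - binomTail (q' n) (m + 1) j) / q n ^ (m + 1)) with hG
  have hGle : ∀ n j, ‖G n j‖ ≤ (j : ℝ) ^ m := fun n j => by
    rw [Real.norm_of_nonneg (le_max_left _ _)]
    refine max_le (by positivity) ?_
    rw [div_le_iff₀ (pow_pos (hq0 n) _)]
    exact binomTail_sub_le (hq'0 n) (hq'q n) (hq1 n) (hqq' n) m j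
  have hGlim : ∀ j, Tendsto (fun n => G n j) atTop (𝓝 0) := fun j => by
    obtain ⟨D, hD, h⟩ := exists_binomTail_sub_le j (m + 1)
    refine squeeze_zero (g := fun n => D * q n) (fun n => le_max_left _ _) (fun n => ?_) ?_
    · refine max_le (mul_nonneg hD (hq0 n).le) ?_
      rw [div_le_iff₀ (pow_pos (hq0 n) _)]
      refine (h _ _ (hq'0 n) (hq'q n) (hq1 n) (hqq' n)).trans_eq ?_
      ring
    · have h := (tendsto_one_div_add_atTop_nhds_zero_nat (𝕜 := ℝ)).const_mul D
      rwa [mul_zero] at h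
  have hlim : Tendsto (fun n => ∫ j, G n j ∂π) atTop (𝓝 (∫ _, 0 ∂π)) :=
    tendsto_integral_of_dominated_convergence _
      (fun n => (measurable_of_countable _).aestronglyMeasurable) hint
      (fun n => ae_of_all _ (hGle n)) (ae_of_all _ hGlim)
  have hGint : ∀ n, Integrable (G n) π := fun n =>
    hint.mono' (measurable_of_countable _).aestronglyMeasurable (ae_of_all _ (hGle n))
  set c := π.real {0} * (step p 0).real {m + 1} with hc
  have hcpos : 0 < c := mul_pos (invariant_real_pos (step_real_pos p) hπ 0) (step_real_pos p _ _)
  have hcle : ∀ n, c ≤ ∫ j, G n j ∂π := by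
    intro n
    have hb := abs_binomTail_le (hq0 n).le (hq1 n) (m + 1)
    have hb' := abs_binomTail_le (hq'0 n) ((hq'q n).trans (hq1 n)) (m + 1)
    have hKb : ∀ j, |kernelOp (step p) (binomTail (q n) (m + 1)) j| ≤ 1 := fun j =>
      abs_integral_le_of_bounded hb
    have hK : ∀ j, binomTail (q' n) (m + 1) j ≤
        kernelOp (step p) (binomTail (q n) (m + 1)) j := by
      intro j
      have h := binomTail_le_integral (eventuallyHalf_strength p) (hq0 n).le (hq1 n) m (j + 1)
      rcases lt_or_ge j (m + 1) with hj | hj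
      · rw [binomTail_of_lt _ hj]
        exact integral_nonneg fun k => (binomTail_mem_Icc (hq0 n).le (hq1 n) _ _).1
      -- With exactly `M = m + 1` cookies the shifts cancel: the comparison is at the same `j` on
      -- both sides.
      · rw [show j + 1 - (m + 1) + m = j by omega] at h
        exact h
    have h0 := mul_le_integral_of_nonneg (μ := π) (fun j => sub_nonneg.2 (hK j))
      ((integrable_of_bounded hKb).sub (integrable_of_bounded hb')) 0
    rw [integral_sub (integrable_of_bounded hKb) (integrable_of_bounded hb'),
      integral_kernelOp hπ hb,
      ← integral_sub (integrable_of_bounded hb) (integrable_of_bounded hb'),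
      binomTail_succ_zero, sub_zero] at h0
    have h1 : (step p 0).real {m + 1} * q n ^ (m + 1) ≤
        kernelOp (step p) (binomTail (q n) (m + 1)) 0 := by
      have := mul_le_integral_of_nonneg (μ := step p 0)
        (fun j => (binomTail_mem_Icc (hq0 n).le (hq1 n) (m + 1) j).1)
        (integrable_of_bounded hb) (m + 1)
      rwa [binomTail_self] at this
    have h2 : c * q n ^ (m + 1) ≤
        ∫ j, (binomTail (q n) (m + 1) j - binomTail (q' n) (m + 1) j) ∂π := by
      refine le_trans ?_ h0
      rw [hc, mul_assoc]
      exact mul_le_mul_of_nonneg_left h1 measureReal_nonneg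
    rw [← le_div_iff₀ (pow_pos (hq0 n) _), ← integral_div] at h2
    refine h2.trans (integral_mono ?_ (hGint n) fun j => le_max_right _ _)
    exact ((integrable_of_bounded hb).sub (integrable_of_bounded hb')).div_const _
  have := ge_of_tendsto' hlim hcle
  simp only [integral_zero] at this
  linarith

/-! ### The marginals of the chain -/

lemma measurable_eval_Iic (n : ℕ) :
    Measurable fun x : Finset.Iic n → ℕ => x ⟨n, by simp⟩ := measurable_pi_apply _

/-- The transition kernels from the paths up to time `n`. -/
def pathKernel {M : ℕ} (p : Cookies M) (n : ℕ) : Kernel (Finset.Iic n → ℕ) ℕ :=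
  (step p).comap (fun h : Finset.Iic n → ℕ => h ⟨n, by simp⟩) (measurable_eval_Iic n)

instance {M : ℕ} (p : Cookies M) (n : ℕ) : IsMarkovKernel (pathKernel p n) := by
  unfold pathKernel; infer_instance

lemma chainLaw_eq {M : ℕ} (p : Cookies M) (z : ℕ) :
    chainLaw p z = Kernel.traj (X := fun _ => ℕ) (pathKernel p) 0 (fun _ => z) := rfl

lemma chainLaw_map_eval {M : ℕ} (p : Cookies M) (z n : ℕ) :
    (chainLaw p z).map (fun Z => Z n) =
      (Kernel.partialTraj (X := fun _ => ℕ) (pathKernel p) 0 n (fun _ => z)).map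
        fun x => x ⟨n, by simp⟩ := by
  rw [← Kernel.traj_map_frestrictLe_apply, Measure.map_map (measurable_eval_Iic n)
    (Preorder.measurable_frestrictLe n), chainLaw_eq]
  rfl

lemma chainLaw_map_zero {M : ℕ} (p : Cookies M) (z : ℕ) :
    (chainLaw p z).map (fun Z => Z 0) = Measure.dirac z := by
  rw [chainLaw_map_eval, Kernel.partialTraj_self, Kernel.id_apply,
    Measure.map_dirac' (measurable_eval_Iic 0)]

lemma chainLaw_map_succ {M : ℕ} (p : Cookies M) (z n : ℕ) :
    (chainLaw p z).map (fun Z => Z (n + 1)) =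
      ((chainLaw p z).map (fun Z => Z n)).bind (step p) := by
  rw [chainLaw_map_eval p z n, chainLaw_eq, ← Kernel.traj_comp_partialTraj (Nat.zero_le n),
    ← Kernel.map_apply _ (measurable_pi_apply (n + 1)), Kernel.map_comp,
    Kernel.map_traj_succ_self]
  ext A hA
  rw [Kernel.comp_apply' _ _ _ hA, Measure.bind_apply hA (step p).measurable.aemeasurable,
    lintegral_map ((step p).measurable_coe hA) (measurable_eval_Iic n)]
  rfl

lemma integral_chainLaw {M : ℕ} (p : Cookies M) (z : ℕ) {f : ℕ → ℝ} {C : ℝ}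
    (hf : ∀ k, |f k| ≤ C) (n : ℕ) :
    ∫ k, f k ∂(chainLaw p z).map (fun Z => Z n) = (kernelOp (step p))^[n] f z := by
  induction n generalizing f with
  | zero => rw [chainLaw_map_zero]; simp
  | succ n ih =>
    have : IsProbabilityMeasure ((chainLaw p z).map (fun Z => Z n)) :=
      Measure.isProbabilityMeasure_map (measurable_pi_apply n).aemeasurable
    rw [chainLaw_map_succ, integral_bind_of_bounded _ _ hf,
      ih (f := kernelOp (step p) f) fun k => abs_integral_le_of_bounded hf,
      Function.iterate_succ_apply]

lemma tendstoInDistribution_chainLaw {M : ℕ} (p : Cookies M) {π : Measure ℕ}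
    [IsProbabilityMeasure π] (hπ : (step p).Invariant π) (z : ℕ) :
    TendstoInDistribution (fun n (Z : ℕ → ℕ) => Z n) atTop (fun k : ℕ => k)
      (fun _ => chainLaw p z) π := by
  refine ⟨fun n => (measurable_pi_apply n).aemeasurable, measurable_id.aemeasurable, ?_⟩
  refine ProbabilityMeasure.tendsto_iff_forall_integral_tendsto.2 fun f => ?_
  have hf : ∀ k, |f k| ≤ ‖f‖ := fun k => f.norm_coe_le_norm k
  have := tendsto_kernelOp_iterate (step_real_pos p) hπ hf z
  refine (this.congr fun n => (integral_chainLaw p z hf n).symm).trans ?_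
  simp

lemma alpha_pos_imp {M : ℕ} (p : Cookies M) (h : 0 < alpha p) : ∃ m, M = m + 1 := by
  cases M with
  | zero => norm_num [alpha] at h
  | succ m => exact ⟨m, rfl⟩

/-- Ergodicity of the branching process for `α > 0`, and the infinite moment of order `M - 1` of
its invariant law. -/
theorem ergodic_of_alpha_pos {M : ℕ} (p : Cookies M) (hα : 0 < alpha p) :
    ∃ (π : Measure ℕ) (_ : IsProbabilityMeasure π),
      (∀ z : ℕ, TendstoInDistribution (fun n (Z : ℕ → ℕ) => Z n) atTop (fun k : ℕ => k)
        (fun _ => chainLaw p z) π) ∧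
      Kernel.Invariant (step p) π ∧
      (∀ π' : Measure ℕ, IsProbabilityMeasure π' → Kernel.Invariant (step p) π' → π' = π) ∧
      ∫⁻ k, (k : ℝ≥0∞) ^ (M - 1) ∂π = ⊤ := by
  obtain ⟨m, rfl⟩ := alpha_pos_imp p hα
  have hpos := step_real_pos p
  obtain ⟨π, hprob, hπ⟩ := exists_invariant_of_drift (step p)
    (fun i h => by simpa [measureReal_def, h] using hpos i 0) (lintegral_step_lt_top p) hα
    (m := m) fun i hi => lintegral_step_le p (by omega)
  exact ⟨π, hprob, tendstoInDistribution_chainLaw p hπ, hπ,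
    fun π' _ hπ' => eq_of_invariant hpos hπ hπ', lintegral_pow_eq_top p hπ⟩

/-! ### A law of large numbers for functionals of the walk with a nonnegative drift -/

/-- The functional `Φ` of paths depends on the path up to time `n` only. -/
def DependsUpTo (n : ℕ) (Φ : (ℕ → ℤ) → ℝ) : Prop := ∀ u v, (∀ i ≤ n, u i = v i) → Φ u = Φ v

/-- The σ-algebra of the path up to time `n`. -/
abbrev pathSigma {Ω : Type*} (X : ℕ → Ω → ℤ) (n : ℕ) : MeasurableSpace Ω :=
  MeasurableSpace.comap (fun ω (i : Fin (n + 1)) => X i ω) inferInstance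

lemma DependsUpTo.measurable {Ω : Type*} {n : ℕ} {Φ : (ℕ → ℤ) → ℝ} (h : DependsUpTo n Φ)
    (X : ℕ → Ω → ℤ) : Measurable[pathSigma X n] fun ω => Φ fun k => X k ω := by
  have : (fun ω => Φ fun k => X k ω) =
      (fun v : Fin (n + 1) → ℤ => Φ fun k => if hk : k < n + 1 then v ⟨k, hk⟩ else 0) ∘
        fun ω (i : Fin (n + 1)) => X i ω := by
    funext ω
    refine h _ _ fun i hi => ?_
    simp [Nat.lt_succ_of_le hi]
  rw [this]
  exact (measurable_of_countable _).comp (comap_measurable _)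

lemma dependsUpTo_strength {M : ℕ} (p : Cookies M) (n : ℕ) :
    DependsUpTo n fun u => (strength p (visitsBefore u n) : ℝ) := by
  intro u v h
  have : visitsBefore u n = visitsBefore v n := by
    unfold visitsBefore
    congr 1
    refine Finset.filter_congr fun i hi => ?_
    rw [h i (Finset.mem_range.1 hi).le, h n le_rfl]
  simp only [this]

/-- A nearest neighbour path from `x`. -/
def IsPath (x : ℤ) (u : ℕ → ℤ) : Prop := u 0 = x ∧ ∀ n, |u (n + 1) - u n| = 1

lemma IsPath.eq_or_eq {x : ℤ} {u : ℕ → ℤ} (h : IsPath x u) (n : ℕ) :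
    u (n + 1) = u n + 1 ∨ u (n + 1) = u n - 1 := by
  rcases (abs_eq zero_le_one).1 (h.2 n) with h | h <;> omega

section Walk

variable {M : ℕ} {p : Cookies M} {x : ℤ} {Ω : Type*} [MeasurableSpace Ω] {μ : Measure Ω}
  {X : ℕ → Ω → ℤ}

lemma IsCookieWalk.ae_isPath (h : IsCookieWalk p x μ X) :
    ∀ᵐ ω ∂μ, IsPath x fun k => X k ω := by
  filter_upwards [h.start, ae_all_iff.2 h.nearest] with ω h0 h1
  exact ⟨h0, h1⟩

lemma IsCookieWalk.pathSigma_le (h : IsCookieWalk p x μ X) (n : ℕ) :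
    pathSigma X n ≤ ‹MeasurableSpace Ω› :=
  (measurable_pi_lambda _ fun i : Fin (n + 1) => h.measurable i).comap_le

lemma IsCookieWalk.measurable_of_dependsUpTo (h : IsCookieWalk p x μ X) {n : ℕ}
    {Φ : (ℕ → ℤ) → ℝ} (hΦ : DependsUpTo n Φ) : Measurable fun ω => Φ fun k => X k ω :=
  (hΦ.measurable X).mono (h.pathSigma_le n) le_rfl

lemma IsCookieWalk.measurableSet_jump (h : IsCookieWalk p x μ X) (n : ℕ) :
    MeasurableSet {ω | X (n + 1) ω = X n ω + 1} :=
  measurableSet_eq_fun (h.measurable (n + 1)) ((h.measurable n).add_const 1)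

lemma IsCookieWalk.integrable_of_bounded (h : IsCookieWalk p x μ X) {n : ℕ} {Φ : (ℕ → ℤ) → ℝ}
    (hΦ : DependsUpTo n Φ) {C : ℝ} (hC : ∀ u, IsPath x u → |Φ u| ≤ C) :
    Integrable (fun ω => Φ fun k => X k ω) μ := by
  have := h.isProbabilityMeasure
  refine Integrable.of_bound (h.measurable_of_dependsUpTo hΦ).aestronglyMeasurable C ?_
  filter_upwards [h.ae_isPath] with ω hω
  exact hC _ hω

/-- The jump of the walk, integrated against a functional of its past. -/
lemma IsCookieWalk.integral_indicator_jump (h : IsCookieWalk p x μ X) {n : ℕ} {Φ : (ℕ → ℤ) → ℝ}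
    (hΦ : DependsUpTo n Φ) {C : ℝ} (hC : ∀ u, IsPath x u → |Φ u| ≤ C) :
    ∫ ω, (Φ fun k => X k ω) * {ω | X (n + 1) ω = X n ω + 1}.indicator 1 ω ∂μ =
      ∫ ω, (Φ fun k => X k ω) * strength p (visitsBefore (fun k => X k ω) n) ∂μ := by
  have := h.isProbabilityMeasure
  have hR := h.measurableSet_jump n
  have hint := h.integrable_of_bounded hΦ hC
  have hg : Integrable ({ω | X (n + 1) ω = X n ω + 1}.indicator (1 : Ω → ℝ)) μ :=
    (integrable_const (1 : ℝ)).indicator hR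
  have hfg : Integrable ((fun ω => Φ fun k => X k ω) *
      {ω | X (n + 1) ω = X n ω + 1}.indicator (1 : Ω → ℝ)) μ := by
    refine hint.mono (hint.aestronglyMeasurable.mul hg.aestronglyMeasurable)
      (ae_of_all _ fun ω => ?_)
    by_cases hω : ω ∈ {ω | X (n + 1) ω = X n ω + 1}
    · simp [Set.indicator_of_mem hω]
    · simp [Set.indicator_of_notMem hω]
  have hpull := condExp_mul_of_stronglyMeasurable_left (m := pathSigma X n)
    (hΦ.measurable X).stronglyMeasurable hfg hg
  have hjump := h.jump n
  rw [← integral_condExp (h.pathSigma_le n)]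
  refine integral_congr_ae ?_
  refine hpull.trans ?_
  filter_upwards [hjump] with ω hω
  rw [Pi.mul_apply]
  congr 1

/-- If the increments of the functional `Φ` are bounded and have nonnegative conditional means,
then `Φ` has no negative speed along the walk. -/
lemma IsCookieWalk.eventually_ge (h : IsCookieWalk p x μ X) {Φ gp gm : ℕ → (ℕ → ℤ) → ℝ}
    (hΦ : ∀ n, DependsUpTo n (Φ n)) (hgp : ∀ n, DependsUpTo n (gp n))
    (hgm : ∀ n, DependsUpTo n (gm n)) {C : ℝ} (hC : 0 < C)
    (h0 : ∀ u, IsPath x u → |Φ 0 u| ≤ C)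
    (hbp : ∀ n u, |gp n u| ≤ C) (hbm : ∀ n u, |gm n u| ≤ C)
    (hstep : ∀ n u, IsPath x u →
      Φ (n + 1) u = Φ n u + if u (n + 1) = u n + 1 then gp n u else gm n u)
    (hdrift : ∀ n u, IsPath x u → 0 ≤ (strength p (visitsBefore u n) : ℝ) * gp n u +
      (1 - strength p (visitsBefore u n)) * gm n u)
    {ε : ℝ} (hε : 0 < ε) : ∀ᵐ ω ∂μ, ∀ᶠ n : ℕ in atTop, -(ε * n) < Φ n fun k => X k ω := by
  have hprob := h.isProbabilityMeasure
  have hbound : ∀ n u, IsPath x u → |Φ n u| ≤ C * (n + 1) := by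
    intro n u hu
    induction n with
    | zero => simpa using h0 u hu
    | succ n ih =>
      rw [hstep n u hu]
      refine (abs_add_le _ _).trans ?_
      have : |if u (n + 1) = u n + 1 then gp n u else gm n u| ≤ C := by
        split_ifs
        exacts [hbp n u, hbm n u]
      push_cast
      linarith
  -- The first bound allows `exp (-l g) ≤ 1 - l g + l ^ 2 C ^ 2` for increments `g`; the second
  -- makes the quadratic cost at most half of the gain `l ε` per step. The tails are then geometric
  -- and Borel-Cantelli applies.
  set l : ℝ := min (1 / C) (ε / (2 * C ^ 2)) with hl
  have hl0 : 0 < l := lt_min (by positivity) (by positivity)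
  have hl1 : l * C ≤ 1 := by
    calc l * C ≤ 1 / C * C := by gcongr; exact min_le_left _ _
      _ = 1 := by field_simp
  have hl2 : l ^ 2 * C ^ 2 ≤ l * ε / 2 := by
    have : l * C ^ 2 ≤ ε / 2 := by
      calc l * C ^ 2 ≤ ε / (2 * C ^ 2) * C ^ 2 := by gcongr; exact min_le_right _ _
        _ = ε / 2 := by field_simp
    nlinarith
  have hexp : ∀ g : ℝ, |g| ≤ C → Real.exp (-l * g) ≤ 1 - l * g + l ^ 2 * C ^ 2 := by
    intro g hg
    have h1 : |-l * g| ≤ 1 := by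
      rw [abs_mul, abs_neg, abs_of_pos hl0]
      exact (mul_le_mul_of_nonneg_left hg hl0.le).trans hl1
    have h2 := (abs_le.1 (Real.abs_exp_sub_one_sub_id_le h1)).2
    have h3 : g ^ 2 ≤ C ^ 2 := sq_le_sq' (abs_le.1 hg).1 (abs_le.1 hg).2
    nlinarith [mul_le_mul_of_nonneg_left h3 (sq_nonneg l)]
  have hdE : ∀ n, DependsUpTo n fun u => Real.exp (-l * Φ n u) := fun n u v huv => by
    simp only [hΦ n u v huv]
  have hbE : ∀ n u, IsPath x u → |Real.exp (-l * Φ n u)| ≤ Real.exp (l * (C * (n + 1))) := by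
    intro n u hu
    rw [abs_of_pos (Real.exp_pos _)]
    refine Real.exp_le_exp.2 ?_
    have := (abs_le.1 (hbound n u hu)).1
    nlinarith
  have hiE : ∀ n, Integrable (fun ω => Real.exp (-l * Φ n fun k => X k ω)) μ := fun n =>
    h.integrable_of_bounded (hdE n) (hbE n)
  have hexp_le : ∀ g : ℝ, |g| ≤ C → Real.exp (-l * g) ≤ 3 := by
    intro g hg
    have h2 : -l * g ≤ 1 := by
      have := (abs_le.1 hg).1
      nlinarith
    linarith [Real.exp_le_exp.2 h2, Real.exp_one_lt_d9]
  have hmgf : ∀ n, ∫ ω, Real.exp (-l * Φ n fun k => X k ω) ∂μ ≤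
      Real.exp (l * C) * (1 + l ^ 2 * C ^ 2) ^ n := by
    intro n
    induction n with
    | zero =>
      have : ∫ ω, Real.exp (-l * Φ 0 fun k => X k ω) ∂μ ≤ ∫ _, Real.exp (l * C) ∂μ := by
        refine integral_mono_ae (hiE 0) (integrable_const _) ?_
        filter_upwards [h.ae_isPath] with ω hω
        have := (abs_le.1 (hbE 0 _ hω)).2
        simpa using this
      simpa using this
    | succ n ih =>
      set E : (ℕ → ℤ) → ℝ := fun u => Real.exp (-l * Φ n u) with hE
      -- `A` is the next exponential after a left step, and `B` the correction for a right step.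
      -- Only `B` multiplies the jump indicator, which is then replaced by its conditional
      -- probability.
      set A : (ℕ → ℤ) → ℝ := fun u => E u * Real.exp (-l * gm n u) with hA
      set B : (ℕ → ℤ) → ℝ :=
        fun u => E u * (Real.exp (-l * gp n u) - Real.exp (-l * gm n u)) with hB
      set W : (ℕ → ℤ) → ℝ := fun u => B u * strength p (visitsBefore u n) with hW
      have hdA : DependsUpTo n A := fun u v huv => by
        simp only [hA, hE, hΦ n u v huv, hgm n u v huv]
      have hdB : DependsUpTo n B := fun u v huv => by
        simp only [hB, hE, hΦ n u v huv, hgm n u v huv, hgp n u v huv]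
      have hdW : DependsUpTo n W := fun u v huv => by
        have hs := dependsUpTo_strength p n u v huv
        simp only at hs
        simp only [hW, hdB u v huv, hs]
      set D := Real.exp (l * (C * (n + 1))) with hD
      have hD0 : 0 < D := Real.exp_pos _
      have hbA : ∀ u, IsPath x u → |A u| ≤ D * 3 := by
        intro u hu
        rw [hA, abs_mul]
        refine mul_le_mul (hbE n u hu) ?_ (abs_nonneg _) hD0.le
        rw [abs_of_pos (Real.exp_pos _)]
        exact hexp_le _ (hbm n u)
      have hbB : ∀ u, IsPath x u → |B u| ≤ D * 3 := by
        intro u hu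
        rw [hB, abs_mul]
        refine mul_le_mul (hbE n u hu) ?_ (abs_nonneg _) hD0.le
        have h1 := hexp_le _ (hbm n u)
        have h2 := hexp_le _ (hbp n u)
        have h3 := Real.exp_pos (-l * gm n u)
        have h4 := Real.exp_pos (-l * gp n u)
        rw [abs_le]
        constructor <;> linarith
      have hbW : ∀ u, IsPath x u → |W u| ≤ D * 3 := by
        intro u hu
        rw [hW, abs_mul, abs_of_nonneg (strength p (visitsBefore u n)).2.1]
        calc _ ≤ D * 3 * 1 := by
              refine mul_le_mul (hbB u hu) (strength p (visitsBefore u n)).2.2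
                (strength p (visitsBefore u n)).2.1 (by positivity)
          _ = _ := mul_one _
      have hiA := h.integrable_of_bounded hdA hbA
      have hiB := h.integrable_of_bounded hdB hbB
      have hiW := h.integrable_of_bounded hdW hbW
      have hiBR : Integrable (fun ω => (B fun k => X k ω) *
          {ω | X (n + 1) ω = X n ω + 1}.indicator 1 ω) μ := by
        refine hiB.mono (hiB.aestronglyMeasurable.mul
          (((integrable_const (1 : ℝ)).indicator (h.measurableSet_jump n)).aestronglyMeasurable))
          (ae_of_all _ fun ω => ?_)
        by_cases hω : ω ∈ {ω | X (n + 1) ω = X n ω + 1}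
        · simp [Set.indicator_of_mem hω]
        · simp [Set.indicator_of_notMem hω]
      have hsplit : ∫ ω, Real.exp (-l * Φ (n + 1) fun k => X k ω) ∂μ =
          ∫ ω, ((A fun k => X k ω) + (B fun k => X k ω) *
            {ω | X (n + 1) ω = X n ω + 1}.indicator 1 ω) ∂μ := by
        refine integral_congr_ae ?_
        filter_upwards [h.ae_isPath] with ω hω
        rw [hstep n _ hω]
        by_cases hr : X (n + 1) ω = X n ω + 1
        · rw [if_pos hr, Set.indicator_of_mem (show ω ∈ {ω | X (n + 1) ω = X n ω + 1} from hr)]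
          simp only [hA, hB, hE, mul_add, Real.exp_add, Pi.one_apply]
          ring
        · rw [if_neg hr, Set.indicator_of_notMem
            (show ω ∉ {ω | X (n + 1) ω = X n ω + 1} from hr)]
          simp only [hA, hE, mul_add, Real.exp_add]
          ring
      rw [hsplit, integral_add hiA hiBR, h.integral_indicator_jump hdB hbB,
        ← integral_add hiA hiW]
      calc ∫ ω, ((A fun k => X k ω) + W fun k => X k ω) ∂μ
          ≤ ∫ ω, (1 + l ^ 2 * C ^ 2) * (E fun k => X k ω) ∂μ := by
            refine integral_mono_ae (hiA.add hiW) ((hiE n).const_mul _) ?_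
            filter_upwards [h.ae_isPath] with ω hω
            set u : ℕ → ℤ := fun k => X k ω
            set s : ℝ := (strength p (visitsBefore u n) : ℝ)
            have hs0 : 0 ≤ s := (strength p (visitsBefore u n)).2.1
            have hs1 : s ≤ 1 := (strength p (visitsBefore u n)).2.2
            have hd : 0 ≤ s * gp n u + (1 - s) * gm n u := hdrift n u hω
            have e1 := mul_le_mul_of_nonneg_left (hexp _ (hbp n u)) hs0
            have e2 := mul_le_mul_of_nonneg_left (hexp _ (hbm n u)) (sub_nonneg.2 hs1)
            have e3 : s * Real.exp (-l * gp n u) + (1 - s) * Real.exp (-l * gm n u) ≤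
                1 + l ^ 2 * C ^ 2 := by nlinarith [mul_nonneg hl0.le hd]
            have e4 := mul_le_mul_of_nonneg_right e3 (Real.exp_pos (-l * Φ n u)).le
            change E u * Real.exp (-l * gm n u) +
              E u * (Real.exp (-l * gp n u) - Real.exp (-l * gm n u)) * s ≤ _ * E u
            change _ * E u ≤ _ * E u at e4
            linarith
        _ = (1 + l ^ 2 * C ^ 2) * ∫ ω, (E fun k => X k ω) ∂μ := integral_const_mul _ _
        _ ≤ (1 + l ^ 2 * C ^ 2) * (Real.exp (l * C) * (1 + l ^ 2 * C ^ 2) ^ n) := by gcongr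
        _ = _ := by ring
  have htail : ∀ n : ℕ, μ {ω | (Φ n fun k => X k ω) ≤ -(ε * n)} ≤
      ENNReal.ofReal (Real.exp (l * C) * Real.exp (-(l * ε / 2)) ^ n) := by
    intro n
    have hm := measure_le_le_exp_mul_mgf (μ := μ) (X := fun ω => Φ n fun k => X k ω) (-(ε * n))
      (neg_nonpos.2 hl0.le) (hiE n)
    rw [← ofReal_measureReal]
    refine ENNReal.ofReal_le_ofReal (hm.trans ?_)
    calc Real.exp (- -l * -(ε * n)) * mgf (fun ω => Φ n fun k => X k ω) μ (-l)
        ≤ Real.exp (- -l * -(ε * n)) * (Real.exp (l * C) * (1 + l ^ 2 * C ^ 2) ^ n) := by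
          gcongr
          exact hmgf n
      _ ≤ Real.exp (- -l * -(ε * n)) * (Real.exp (l * C) * Real.exp (l * ε / 2) ^ n) := by
          gcongr
          linarith [Real.add_one_le_exp (l * ε / 2)]
      _ = _ := by
          rw [← Real.exp_nat_mul, ← Real.exp_nat_mul, mul_left_comm, ← Real.exp_add]
          congr 2
          ring
  have hsum : ∑' n : ℕ, μ {ω | (Φ n fun k => X k ω) ≤ -(ε * n)} ≠ ⊤ := by
    refine ne_top_of_le_ne_top ?_ (ENNReal.tsum_le_tsum htail)
    refine Summable.tsum_ofReal_ne_top
      ((summable_geometric_of_lt_one (Real.exp_pos _).le ?_).mul_left _)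
    rw [Real.exp_lt_one_iff]
    have := mul_pos hl0 hε
    linarith
  filter_upwards [ae_eventually_notMem hsum] with ω hω
  filter_upwards [hω] with n hn
  exact not_le.1 hn

lemma half_le_strength (p : Cookies M) (i : ℕ) : 1 / 2 ≤ (strength p i : ℝ) := by
  unfold strength
  split_ifs with h
  · exact (p ⟨i, h⟩).2.1
  · exact le_rfl

lemma IsCookieWalk.eventually_ge_neg_mul (h : IsCookieWalk p x μ X) {ε : ℝ} (hε : 0 < ε) :
    ∀ᵐ ω ∂μ, ∀ᶠ n : ℕ in atTop, -(ε * n) < (X n ω : ℝ) - x := by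
  refine h.eventually_ge (Φ := fun n u => (u n : ℝ) - x) (gp := fun _ _ => 1)
    (gm := fun _ _ => -1) (C := 1) (fun n u v huv => by simp only [huv n le_rfl])
    (fun _ _ _ _ => rfl) (fun _ _ _ _ => rfl) one_pos (fun u hu => by simp [hu.1])
    (by simp) (by simp) (fun n u hu => ?_) (fun n u _ => ?_) hε
  · rcases hu.eq_or_eq n with h | h
    · rw [if_pos h, h]; push_cast; ring
    · rw [if_neg (by omega), h]; push_cast; ring
  · linarith [half_le_strength p (visitsBefore u n)]

end Walk

/-! ### Excursions below the maximum of a path -/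

/-- The position of a path relative to its maximum `top`: it is at `top - depth`, and `top - low`
is the minimum of the current excursion below `top`. The flag `fresh` tells that the present
position is visited for the first time by the excursion. -/
structure ExcState where
  top : ℤ
  depth : ℕ
  low : ℕ
  fresh : Bool

/-- The state after a step to the right or to the left. -/
def ExcState.next (s : ExcState) (right : Bool) : ExcState :=
  if right then
    match s.depth with
    | 0 => ⟨s.top + 1, 0, 0, false⟩
    | 1 => ⟨s.top, 0, 0, false⟩
    | r + 2 => ⟨s.top, r + 1, s.low, false⟩
  else if s.depth = s.low then ⟨s.top, s.low + 1, s.low + 1, true⟩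
  else ⟨s.top, s.depth + 1, s.low, false⟩

/-- The states of a nearest neighbour path. -/
def excState (u : ℕ → ℤ) : ℕ → ExcState
  | 0 => ⟨u 0, 0, 0, false⟩
  | n + 1 => (excState u n).next (decide (u (n + 1) = u n + 1))

lemma excState_congr {u v : ℕ → ℤ} {n : ℕ} (h : ∀ i ≤ n, u i = v i) :
    excState u n = excState v n := by
  induction n with
  | zero => simp [excState, h 0 le_rfl]
  | succ n ih =>
    rw [excState, excState, ih fun i hi => h i (by omega), h n (by omega), h (n + 1) le_rfl]

/-- The properties of the states that occur along a path. -/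
structure ExcState.Valid (s : ExcState) : Prop where
  depth_le : s.depth ≤ s.low
  of_depth_eq_zero : s.depth = 0 → s.low = 0 ∧ s.fresh = false
  of_fresh : s.fresh = true → s.depth = s.low

lemma ExcState.Valid.next {s : ExcState} (h : s.Valid) (right : Bool) : (s.next right).Valid := by
  obtain ⟨t, r, d, f⟩ := s
  obtain ⟨h1, h2, h3⟩ := h
  simp only at h1 h2 h3
  cases right with
  | true =>
    match r, h1 with
    | 0, _ => exact ⟨by simp [ExcState.next], by simp [ExcState.next], by simp [ExcState.next]⟩
    | 1, _ => exact ⟨by simp [ExcState.next], by simp [ExcState.next], by simp [ExcState.next]⟩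
    | r + 2, h1 =>
      exact ⟨by simp [ExcState.next]; omega, by simp [ExcState.next], by simp [ExcState.next]⟩
  | false =>
    by_cases hrd : r = d
    · exact ⟨by simp [ExcState.next, hrd], by simp [ExcState.next, hrd],
        by simp [ExcState.next, hrd]⟩
    · exact ⟨by simp [ExcState.next, hrd]; omega, by simp [ExcState.next, hrd],
        by simp [ExcState.next, hrd]⟩

lemma excState_valid (u : ℕ → ℤ) (n : ℕ) : (excState u n).Valid := by
  induction n with
  | zero => exact ⟨le_rfl, fun _ => ⟨rfl, rfl⟩, by simp [excState]⟩
  | succ n ih => exact ih.next _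

/-- The number of visits of the path `u` to `y` up to time `n`. -/
def visits (u : ℕ → ℤ) (n : ℕ) (y : ℤ) : ℕ := ((Finset.range (n + 1)).filter fun i => u i = y).card

lemma visits_zero (u : ℕ → ℤ) (y : ℤ) : visits u 0 y = if u 0 = y then 1 else 0 := by
  simp only [visits, Finset.card_filter]
  rw [Finset.sum_range_one]

lemma visits_succ (u : ℕ → ℤ) (n : ℕ) (y : ℤ) :
    visits u (n + 1) y = visits u n y + if u (n + 1) = y then 1 else 0 := by
  simp only [visits, Finset.card_filter]
  rw [Finset.sum_range_succ]

lemma visits_self (u : ℕ → ℤ) (n : ℕ) : visits u n (u n) = visitsBefore u n + 1 := by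
  simp only [visits, visitsBefore, Finset.card_filter]
  rw [Finset.sum_range_succ]
  simp

/-- What the state of a path tells about the numbers of visits. -/
structure VisitBounds (x : ℤ) (u : ℕ → ℤ) (n : ℕ) (s : ExcState) : Prop where
  pos_eq : u n = s.top - s.depth
  one_le : ∀ y, x ≤ y → y ≤ s.top → 1 ≤ visits u n y
  two_le : ∀ y, x ≤ y → s.top - s.low ≤ y → y < s.top → 2 ≤ visits u n y
  three_le : s.fresh = false → 1 ≤ s.depth → x ≤ u n → 3 ≤ visits u n (u n)

/-- The successive visits to a site of the excursion are: one when the maximum first passed it, one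
when the excursion first reached it, and a further one whenever it is not fresh. Earlier excursions
can only add visits. -/
lemma VisitBounds.next {x : ℤ} {u : ℕ → ℤ} {n : ℕ} {s : ExcState} (hs : s.Valid)
    (h : VisitBounds x u n s) (hu : u (n + 1) = u n + 1 ∨ u (n + 1) = u n - 1) :
    VisitBounds x u (n + 1) (s.next (decide (u (n + 1) = u n + 1))) := by
  obtain ⟨t, r, d, f⟩ := s
  obtain ⟨hrd, hr0, hf⟩ := hs
  obtain ⟨h1, h2, h3, h4⟩ := h
  simp only at hrd hr0 hf h1 h2 h3 h4
  have hmono : ∀ y, visits u n y ≤ visits u (n + 1) y := fun y => by rw [visits_succ]; omega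
  have hnew : visits u (n + 1) (u (n + 1)) = visits u n (u (n + 1)) + 1 := by
    rw [visits_succ]; simp
  by_cases hr : u (n + 1) = u n + 1
  · rw [decide_eq_true hr]
    match r, hrd, hr0, hf, h1, h4 with
    | 0, _, _, _, h1, _ =>
      refine ⟨?_, fun y hxy hy => ?_, fun y hxy hy hyt => ?_, fun _ hd => ?_⟩ <;>
        simp only [ExcState.next, if_true] at *
      · rw [hr, h1]; push_cast; ring
      · rcases eq_or_ne y (u (n + 1)) with rfl | hne
        · omega
        · exact (h2 y hxy (by push_cast at h1; omega)).trans (hmono y)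
      · push_cast at hy; omega
      · omega
    | 1, _, _, _, h1, _ =>
      refine ⟨?_, fun y hxy hy => ?_, fun y hxy hy hyt => ?_, fun _ hd => ?_⟩ <;>
        simp only [ExcState.next, if_true] at *
      · rw [hr, h1]; push_cast; ring
      · exact (h2 y hxy hy).trans (hmono y)
      · push_cast at hy; omega
      · omega
    | r + 2, hrd, _, _, h1, _ =>
      refine ⟨?_, fun y hxy hy => ?_, fun y hxy hy hyt => ?_, fun _ hd hx => ?_⟩ <;>
        simp only [ExcState.next, if_true] at *
      · rw [hr, h1]; push_cast; ring
      · exact (h2 y hxy hy).trans (hmono y)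
      · exact (h3 y hxy hy hyt).trans (hmono y)
      · have := h3 (u (n + 1)) hx (by push_cast at h1; omega) (by push_cast at h1; omega)
        omega
  · have hl : u (n + 1) = u n - 1 := by omega
    rw [decide_eq_false hr]
    by_cases hd : r = d
    · subst hd
      refine ⟨?_, fun y hxy hy => ?_, fun y hxy hy hyt => ?_, fun hfr => ?_⟩ <;>
        simp only [ExcState.next, if_true, Bool.false_eq_true, if_false, reduceCtorEq] at *
      · rw [hl, h1]; push_cast; ring
      · exact (h2 y hxy hy).trans (hmono y)
      · rcases eq_or_ne y (u (n + 1)) with rfl | hne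
        · have := h2 (u (n + 1)) hxy hyt.le
          omega
        · exact (h3 y hxy (by push_cast at hy; omega) hyt).trans (hmono y)
    · refine ⟨?_, fun y hxy hy => ?_, fun y hxy hy hyt => ?_, fun _ _ hx => ?_⟩ <;>
        simp only [ExcState.next, if_neg hd, Bool.false_eq_true, if_false] at *
      · rw [hl, h1]; push_cast; ring
      · exact (h2 y hxy hy).trans (hmono y)
      · exact (h3 y hxy hy hyt).trans (hmono y)
      · have := h3 (u (n + 1)) hx (by omega) (by omega)
        omega

lemma IsPath.visitBounds {x : ℤ} {u : ℕ → ℤ} (hu : IsPath x u) (n : ℕ) :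
    VisitBounds x u n (excState u n) := by
  induction n with
  | zero =>
    refine ⟨by simp [excState], fun y hxy hy => ?_, fun y hxy hy hyt => ?_, fun _ hd => ?_⟩ <;>
      simp only [excState] at *
    · rw [visits_zero, if_pos (le_antisymm (hu.1.le.trans hxy) hy)]
    · push_cast at hy; omega
    · omega
  | succ n ih => exact ih.next (excState_valid u n) (hu.eq_or_eq n)

/-! ### A potential for the duration of the excursions -/

/-- The product of the `1 - 2 q / e` over `2 ≤ e ≤ d`. -/
def descentWeight (q : ℝ) : ℕ → ℝ
  | 0 => 1
  | 1 => 1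
  | d + 2 => descentWeight q (d + 1) * (1 - 2 * q / (d + 2))

lemma descentWeight_pos {q : ℝ} (hq : q < 1) : ∀ d, 0 < descentWeight q d
  | 0 => one_pos
  | 1 => one_pos
  | d + 2 => by
    refine mul_pos (descentWeight_pos hq (d + 1)) ?_
    rw [sub_pos, div_lt_one (by positivity)]
    have : (0 : ℝ) ≤ d := d.cast_nonneg
    linarith

lemma descentWeight_succ (q : ℝ) {d : ℕ} (hd : 1 ≤ d) :
    descentWeight q (d + 1) = descentWeight q d * (1 - 2 * q / (d + 1)) := by
  obtain ⟨d, rfl⟩ : ∃ e, d = e + 1 := ⟨d - 1, by omega⟩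
  rw [descentWeight]
  push_cast
  ring

/-- Comparison with `q = 1` in the factors from `3` on, where the product of the `1 - 2 / e`
telescopes; the factor `1 - q` comes from `e = 2`. -/
lemma le_mul_descentWeight {q : ℝ} (hq : q < 1) (e : ℕ) :
    2 * (1 - q) ≤ ((e : ℝ) + 1) * (e + 2) * descentWeight q (e + 2) := by
  induction e with
  | zero => simp [descentWeight]
  | succ e ih =>
    rw [show e + 1 + 2 = (e + 2) + 1 by ring, descentWeight_succ q (by omega)]
    have hw := descentWeight_pos hq (e + 2)
    have he : (0 : ℝ) ≤ e := e.cast_nonneg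
    refine ih.trans ?_
    have : (((e + 1 : ℕ) : ℝ) + 1) * ((e + 1 : ℕ) + 2) *
        (descentWeight q (e + 2) * (1 - 2 * q / ((e + 2 : ℕ) + 1))) =
        ((e : ℝ) + 3 - 2 * q) * (e + 2) * descentWeight q (e + 2) := by
      push_cast
      field_simp
      ring
    rw [this]
    gcongr
    linarith

/-- A lower bound for the mean duration of an excursion which has just reached the depth `d` for
the first time, until its end or until it reaches the depth `L`. -/
def descentTime (q : ℝ) (L d : ℕ) : ℝ :=
  (∑ e ∈ Finset.Ico d L, (e : ℝ) * descentWeight q e) / descentWeight q d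

lemma descentTime_nonneg {q : ℝ} (hq : q < 1) (L d : ℕ) : 0 ≤ descentTime q L d :=
  div_nonneg (Finset.sum_nonneg fun e _ => mul_nonneg e.cast_nonneg (descentWeight_pos hq e).le)
    (descentWeight_pos hq d).le

lemma descentTime_of_le (q : ℝ) {L d : ℕ} (h : L ≤ d) : descentTime q L d = 0 := by
  simp [descentTime, Finset.Ico_eq_empty_of_le h]

/-- Gambler's ruin: from a fresh depth `d`, stepping right with probability `q` and fairly
afterwards, depth `d + 1` is reached before `0` with probability `1 - q + q (d - 1) / (d + 1) = 1 -
2 q / (d + 1)`. The time taken has mean `1 + 2 q (d - 1)`, at least `d` when `q ≥ 1/2`. -/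
lemma descentTime_eq {q : ℝ} (hq : q < 1) {L d : ℕ} (hd : 1 ≤ d) (h : d < L) :
    descentTime q L d = d + descentTime q L (d + 1) * (1 - 2 * q / (d + 1)) := by
  have h1 := (descentWeight_pos hq d).ne'
  have h2 := (descentWeight_pos hq (d + 1)).ne'
  have h3 : (1 - 2 * q / ((d : ℝ) + 1)) = descentWeight q (d + 1) / descentWeight q d := by
    rw [descentWeight_succ q hd, mul_div_cancel_left₀ _ h1]
  rw [h3, descentTime, descentTime, Finset.sum_eq_sum_Ico_succ_bot h]
  field_simp

lemma exists_le_descentTime {q : ℝ} (hq : q < 1) (K : ℝ) : ∃ L, K ≤ descentTime q L 1 := by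
  have hlim := (Real.tendsto_sum_range_one_div_nat_succ_atTop).const_mul_atTop
    (show 0 < 2 * (1 - q) by linarith)
  obtain ⟨N, hN⟩ := (hlim.eventually_ge_atTop K).exists
  refine ⟨N + 2, hN.trans ?_⟩
  rw [descentTime, show descentWeight q 1 = 1 from rfl, div_one,
    Finset.sum_eq_sum_Ico_succ_bot (by omega), Finset.sum_Ico_eq_sum_range, Finset.mul_sum]
  simp only [Nat.cast_one, descentWeight, mul_one, one_add_one_eq_two, Nat.add_sub_cancel]
  refine (Finset.sum_le_sum fun e _ => ?_).trans (le_add_of_nonneg_left zero_le_one)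
  have h := le_mul_descentWeight hq e
  rw [mul_one_div, div_le_iff₀ (by positivity), add_comm 2 e]
  push_cast
  linarith

/-- The part of the potential given by the current excursion. -/
def excBonus (F : ℕ → ℝ) (L : ℕ) (b : ℤ) (s : ExcState) : ℝ :=
  if s.top < b ∨ L ≤ s.low then 0
  else if s.fresh then F s.low
  -- For a fair walk at `depth` between `0` and `low + 1`: the mean exit time, plus the probability
  -- of leaving at the new depth `low + 1` times the value there.
  else s.depth * (s.low + 1 - s.depth) + s.depth / (s.low + 1) * F (s.low + 1)

/-- The potential of a state. -/
def excValue (F : ℕ → ℝ) (L : ℕ) (b : ℤ) (K : ℝ) (s : ExcState) : ℝ :=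
  excBonus F L b s - K * (max (s.top - b) 0 : ℤ)

lemma excBonus_mem_Icc {F : ℕ → ℝ} {B : ℝ} (hF : ∀ d, F d ∈ Set.Icc 0 B) (L : ℕ) (b : ℤ)
    {s : ExcState} (hs : s.Valid) : excBonus F L b s ∈ Set.Icc 0 (L * (L + 1) + B) := by
  have hB : 0 ≤ B := (hF 0).1.trans (hF 0).2
  unfold excBonus
  split_ifs with h1 h2
  · exact ⟨le_rfl, by positivity⟩
  · exact ⟨(hF _).1, (hF _).2.trans (le_add_of_nonneg_left (by positivity))⟩
  · have h3 : (s.depth : ℝ) ≤ s.low := by exact_mod_cast hs.depth_le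
    have h4 : (s.low : ℝ) ≤ L := by exact_mod_cast (not_le.1 (not_or.1 h1).2).le
    have h5 : (0 : ℝ) ≤ s.depth := s.depth.cast_nonneg
    have h6 : (s.depth : ℝ) / (s.low + 1) ≤ 1 := by
      rw [div_le_one (by positivity)]; linarith
    constructor
    · exact add_nonneg (mul_nonneg h5 (by linarith)) (mul_nonneg (by positivity) (hF _).1)
    · refine add_le_add (mul_le_mul (h3.trans h4) (by linarith) (by linarith) (by positivity)) ?_
      exact (mul_le_of_le_one_left (hF _).1 h6).trans (hF _).2

lemma ExcState.top_next (s : ExcState) (right : Bool) :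
    (s.next right).top = s.top ∨ (s.next right).top = s.top + 1 := by
  obtain ⟨t, r, d, f⟩ := s
  cases right with
  | true =>
    match r with
    | 0 => simp [next]
    | 1 => simp [next]
    | r + 2 => simp [next]
  | false => by_cases h : r = d <;> simp [next, h]

lemma abs_excValue_next_sub_le {F : ℕ → ℝ} {B : ℝ} (hF : ∀ d, F d ∈ Set.Icc 0 B) (L : ℕ) (b : ℤ)
    {K : ℝ} (hK : 0 ≤ K) {s : ExcState} (hs : s.Valid) (right : Bool) :
    |1 + excValue F L b K (s.next right) - excValue F L b K s| ≤ 1 + (L * (L + 1) + B) + K := by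
  obtain ⟨h1, h2⟩ := excBonus_mem_Icc hF L b hs
  obtain ⟨h3, h4⟩ := excBonus_mem_Icc hF L b (hs.next right)
  have h5 : (max ((s.next right).top - b) 0 : ℤ) = max (s.top - b) 0 ∨
      (max ((s.next right).top - b) 0 : ℤ) = max (s.top - b) 0 + 1 := by
    rcases s.top_next right with h | h <;> omega
  unfold excValue
  rw [abs_le]
  rcases h5 with h | h <;> rw [h] <;> push_cast <;> constructor <;> linarith

/-- The potential plus elapsed time has nonnegative drift. At the maximum, a step right costs `K`
and a step left, of probability at least `1 - q₀`, opens an excursion worth `descentTime q₂ L 1`;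
inside an excursion the potential is the expected remaining time or a lower bound for it. -/
lemma excValue_drift {q₂ q₀ K : ℝ} (hq₂ : q₂ < 1) (hK : 0 ≤ K) {L : ℕ}
    (hL : K ≤ (1 - q₀) * descentTime q₂ L 1) (b : ℤ) {s : ExcState} (hs : s.Valid) {q : ℝ}
    (h0 : 0 ≤ q) (h1 : q ≤ 1) (hq₀ : q ≤ q₀)
    (hfresh : b ≤ s.top → s.low < L → 1 ≤ s.depth → s.fresh = true → 1 / 2 ≤ q ∧ q ≤ q₂)
    (hold : b ≤ s.top → s.low < L → 1 ≤ s.depth → s.fresh = false → q = 1 / 2) :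
    0 ≤ q * (1 + excValue (descentTime q₂ L) L b K (s.next true) -
        excValue (descentTime q₂ L) L b K s) +
      (1 - q) * (1 + excValue (descentTime q₂ L) L b K (s.next false) -
        excValue (descentTime q₂ L) L b K s) := by
  set F := descentTime q₂ L with hF
  have hF0 : ∀ d, 0 ≤ F d := descentTime_nonneg hq₂ L
  have hbonus : ∀ {s : ExcState}, s.Valid → 0 ≤ excBonus F L b s := by
    intro s hs
    unfold excBonus
    split_ifs with h1 h2
    · exact le_rfl
    · exact hF0 _
    · have h3 : (s.depth : ℝ) ≤ s.low := by exact_mod_cast hs.depth_le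
      exact add_nonneg (mul_nonneg s.depth.cast_nonneg (by linarith))
        (mul_nonneg (by positivity) (hF0 _))
  have key : excValue F L b K s ≤
      1 + q * excValue F L b K (s.next true) + (1 - q) * excValue F L b K (s.next false) := by
    have hnt := hbonus (hs.next true)
    have hnf := hbonus (hs.next false)
    have hq1 := sub_nonneg.2 h1
    rcases lt_or_ge s.top b with htop | htop
    · have e : ∀ c, (max ((s.next c).top - b) 0 : ℤ) = 0 := fun c => by
        rcases s.top_next c with h | h <;> omega
      have e' : (max (s.top - b) 0 : ℤ) = 0 := by omega
      simp only [excValue, e, e']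
      rw [show excBonus F L b s = 0 by simp [excBonus, htop]]
      have := mul_nonneg h0 hnt
      have := mul_nonneg hq1 hnf
      push_cast
      linarith
    obtain ⟨t, r, d, f⟩ := s
    obtain ⟨hrd, hr0, hf⟩ := hs
    simp only at hrd hr0 hf htop hfresh hold
    have htb : ¬ t < b := not_lt.2 htop
    have htb1 : ¬ t + 1 < b := by omega
    match r, hrd, hr0, hf, hfresh, hold, hnt, hnf with
    | 0, _, hr0, _, _, _, _, _ =>
      obtain ⟨rfl, rfl⟩ := hr0 rfl
      have e1 : (max (t + 1 - b) 0 : ℤ) = max (t - b) 0 + 1 := by omega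
      have e2 : (if L ≤ 1 then 0 else F 1) = F 1 := by
        split_ifs with h
        · exact (descentTime_of_le q₂ h).symm
        · rfl
      simp [excValue, excBonus, ExcState.next, htb, htb1, e1, e2]
      have := mul_le_mul_of_nonneg_right (sub_le_sub_left hq₀ 1) (hF0 1)
      have := mul_le_mul_of_nonneg_right h1 hK
      nlinarith
    | r + 1, hrd, _, hf, hfresh, hold, hnt, hnf =>
      have ht : ∀ c, (ExcState.next ⟨t, r + 1, d, f⟩ c).top = t := by
        intro c
        cases c with
        | true => cases r <;> simp [ExcState.next]
        | false => by_cases h : r + 1 = d <;> simp [ExcState.next, h]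
      simp only [excValue, ht]
      suffices h : excBonus F L b ⟨t, r + 1, d, f⟩ ≤
          1 + q * excBonus F L b (ExcState.next ⟨t, r + 1, d, f⟩ true) +
            (1 - q) * excBonus F L b (ExcState.next ⟨t, r + 1, d, f⟩ false) by linarith
      rcases le_or_gt L d with hLd | hLd
      · rw [show excBonus F L b ⟨t, r + 1, d, f⟩ = 0 by simp [excBonus, hLd]]
        have := mul_nonneg h0 hnt
        have := mul_nonneg hq1 hnf
        linarith
      have hLd' : ¬ L ≤ d := not_le.2 hLd
      have hright : excBonus F L b (ExcState.next ⟨t, r + 1, d, f⟩ true) =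
          r * (d + 1 - r) + r / (d + 1) * F (d + 1) := by
        cases r <;> simp [excBonus, ExcState.next, htb, hLd']
      -- Cutting the bonus off at depth `L` agrees with `F`, which vanishes there.
      have hnew : (if L ≤ d + 1 then 0 else F (d + 1)) = F (d + 1) := by
        split_ifs with h
        · exact (descentTime_of_le q₂ h).symm
        · rfl
      have hd0 : (0 : ℝ) < (d : ℝ) + 1 := by positivity
      have hdeep : r + 1 = d →
          excBonus F L b (ExcState.next ⟨t, r + 1, d, f⟩ false) = F (d + 1) := by
        intro h
        simp [excBonus, ExcState.next, h, htb, hnew]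
      rw [hright]
      cases f with
      | true =>
        obtain rfl : r + 1 = d := hf rfl
        obtain ⟨hq1, hq2⟩ := hfresh htop hLd (by omega) rfl
        rw [hdeep rfl]
        have hval : excBonus F L b ⟨t, r + 1, r + 1, true⟩ = F (r + 1) := by
          simp [excBonus, htb, hLd']
        rw [hval, hF, descentTime_eq hq₂ (by omega) hLd, ← hF]
        push_cast at hd0 ⊢
        have hm : q * (F (r + 1 + 1) / ((r : ℝ) + 1 + 1)) ≤
            q₂ * (F (r + 1 + 1) / ((r : ℝ) + 1 + 1)) :=
          mul_le_mul_of_nonneg_right hq2 (div_nonneg (hF0 _) hd0.le)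
        have hr : (0 : ℝ) ≤ r := r.cast_nonneg
        have e1 : F (r + 1 + 1) * (1 - 2 * q₂ / ((r : ℝ) + 1 + 1)) =
          F (r + 1 + 1) - 2 * (q₂ * (F (r + 1 + 1) / ((r : ℝ) + 1 + 1))) := by ring
        have e2 : (r : ℝ) / (r + 1 + 1) * F (r + 1 + 1) =
            F (r + 1 + 1) - 2 * (F (r + 1 + 1) / ((r : ℝ) + 1 + 1)) := by
          field_simp
          ring
        rw [e1, e2]
        nlinarith [mul_le_mul_of_nonneg_right hq1 hr]
      | false =>
        obtain rfl := hold htop hLd (by omega) rfl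
        have hval : excBonus F L b ⟨t, r + 1, d, false⟩ =
            (r + 1) * (d + 1 - (r + 1)) + (r + 1) / (d + 1) * F (d + 1) := by
          simp [excBonus, htb, hLd']
        have hleft : excBonus F L b (ExcState.next ⟨t, r + 1, d, false⟩ false) =
            (r + 2) * (d + 1 - (r + 2)) + (r + 2) / (d + 1) * F (d + 1) := by
          -- At the bottom of the excursion the left step reaches the fresh depth `d + 1`, where the
          -- formula for old sites also gives `F (d + 1)`.
          by_cases h : r + 1 = d
          · rw [hdeep h, ← h]
            push_cast
            field_simp
            ring
          · simp only [excBonus, ExcState.next, h, if_false, Bool.false_eq_true, htb, hLd', or_self]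
            push_cast
            ring
        rw [hval, hleft]
        field_simp
        nlinarith
  nlinarith

/-! ### Two cookies give no speed -/

lemma strength_two_of_le {p : Cookies 2} {i : ℕ} (h : 2 ≤ i) : (strength p i : ℝ) = 1 / 2 :=
  eventuallyHalf_strength p i h

lemma strength_two_le {p : Cookies 2} {i : ℕ} (h : 1 ≤ i) : (strength p i : ℝ) ≤ p 1 := by
  rcases Nat.lt_or_ge i 2 with h2 | h2
  · obtain rfl : i = 1 := by omega
    simp [strength]
  · rw [strength_two_of_le h2]
    exact (p 1).2.1

lemma strength_two_le_max (p : Cookies 2) (i : ℕ) : (strength p i : ℝ) ≤ max (p 0) (p 1) := by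
  rcases Nat.eq_zero_or_pos i with rfl | h
  · simp [strength]
  · exact (strength_two_le h).trans (le_max_right _ _)

section Walk

variable {p : Cookies 2} {x : ℤ} {Ω : Type*} [MeasurableSpace Ω] {μ : Measure Ω}
  {X : ℕ → Ω → ℤ}

lemma IsCookieWalk.exists_eventually_mul_le (h : IsCookieWalk p x μ X) {K : ℝ} (hK : 0 ≤ K) :
    ∃ B : ℝ, ∀ᵐ ω ∂μ, ∀ᶠ n : ℕ in atTop, K * X n ω ≤ 2 * n + B := by
  set q₂ : ℝ := (p 1 : ℝ)
  set q₀ : ℝ := max (p 0 : ℝ) (p 1)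
  have hq₂1 : q₂ < 1 := (p 1).2.2
  have hq₀1 : q₀ < 1 := max_lt (p 0).2.2 (p 1).2.2
  obtain ⟨L, hL⟩ := exists_le_descentTime hq₂1 (K / (1 - q₀))
  rw [div_le_iff₀' (sub_pos.2 hq₀1)] at hL
  set F := descentTime q₂ L with hF
  have hF0 : ∀ d, 0 ≤ F d := descentTime_nonneg hq₂1 L
  set B : ℝ := ∑ d ∈ Finset.range L, F d with hB
  have hFB : ∀ d, F d ∈ Set.Icc 0 B := by
    refine fun d => ⟨hF0 d, ?_⟩
    rcases lt_or_ge d L with hd | hd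
    · exact Finset.single_le_sum (fun e _ => hF0 e) (Finset.mem_range.2 hd)
    · rw [hF, descentTime_of_le q₂ hd]
      exact Finset.sum_nonneg fun e _ => hF0 e
  have hB0 : 0 ≤ B := (hFB 0).1.trans (hFB 0).2
  -- With the maximum at least `x + L` and an excursion of depth less than `L`, the walk stays above
  -- `x`, where all sites up to the maximum have been visited.
  set b : ℤ := x + L with hb
  set V := excValue F L b K with hV
  -- With `ε = 1` the conclusion reads `n + V > -n`; the bonus being bounded, this is the bound `K
  -- X_n ≤ 2 n + const`.
  have hev := h.eventually_ge (Φ := fun n u => n + V (excState u n))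
    (gp := fun n u => 1 + V ((excState u n).next true) - V (excState u n))
    (gm := fun n u => 1 + V ((excState u n).next false) - V (excState u n))
    (C := 1 + (L * (L + 1) + B) + K)
    (fun n u v huv => by simp only [excState_congr huv])
    (fun n u v huv => by simp only [excState_congr huv])
    (fun n u v huv => by simp only [excState_congr huv]) (by positivity)
    (fun u hu => ?_) (fun n u => abs_excValue_next_sub_le hFB L b hK (excState_valid u n) true)
    (fun n u => abs_excValue_next_sub_le hFB L b hK (excState_valid u n) false)
    (fun n u hu => ?_) (fun n u hu => ?_) one_pos
  · refine ⟨L * (L + 1) + B + K * b, ?_⟩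
    filter_upwards [hev, h.ae_isPath] with ω hω hpath
    filter_upwards [hω] with n hn
    have hbd := (excBonus_mem_Icc hFB L b (excState_valid (fun k => X k ω) n)).2
    have hpos := (hpath.visitBounds n).pos_eq
    set s := excState (fun k => X k ω) n
    have hle : (X n ω : ℝ) - b ≤ (max (s.top - b) 0 : ℤ) := by
      have : X n ω - b ≤ max (s.top - b) 0 := by omega
      exact_mod_cast this
    have := mul_le_mul_of_nonneg_left hle hK
    change -(1 * (n : ℝ)) < n + (excBonus F L b s - K * (max (s.top - b) 0 : ℤ)) at hn
    linarith
  · have : V (excState u 0) = 0 := by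
      have e : (max (x - b) 0 : ℤ) = 0 := by omega
      simp [hV, excValue, excBonus, excState, hu.1, e]
    simp only [this]
    simp
    positivity
  · rw [excState]
    by_cases hr : u (n + 1) = u n + 1
    · rw [if_pos hr, decide_eq_true hr]
      push_cast
      ring
    · rw [if_neg hr, decide_eq_false hr]
      push_cast
      ring
  · have hvb := hu.visitBounds n
    have hval := excState_valid u n
    have hself := visits_self u n
    have hpos := hvb.pos_eq
    have hdl := hval.depth_le
    refine excValue_drift hq₂1 hK hL b hval (strength p _).2.1 (strength p _).2.2
      (strength_two_le_max p _) (fun htop hlow hd hf => ⟨half_le_strength p _, ?_⟩)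
      (fun htop hlow hd hf => ?_)
    · refine strength_two_le ?_
      have := hvb.two_le (u n) (by omega) (by omega) (by omega)
      omega
    · refine strength_two_of_le ?_
      have := hvb.three_le hf hd (by omega)
      omega

theorem IsCookieWalk.hasSpeed_zero (h : IsCookieWalk p x μ X) : HasSpeed μ X 0 := by
  have hlow : ∀ k : ℕ, ∀ᵐ ω ∂μ, ∀ᶠ n : ℕ in atTop,
      -(1 / ((k : ℝ) + 1) * n) < (X n ω : ℝ) - x := fun k =>
    h.eventually_ge_neg_mul (by positivity)
  have hup : ∀ k : ℕ, ∃ B : ℝ, ∀ᵐ ω ∂μ, ∀ᶠ n : ℕ in atTop,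
      ((k : ℝ) + 1) * X n ω ≤ 2 * n + B := fun k =>
    h.exists_eventually_mul_le (by positivity)
  choose B hB using hup
  filter_upwards [ae_all_iff.2 hlow, ae_all_iff.2 hB] with ω hl hu
  rw [Metric.tendsto_atTop']
  intro ε hε
  obtain ⟨k, hk⟩ := exists_nat_one_div_lt (show 0 < ε / 4 by positivity)
  have hev : ∀ᶠ n : ℕ in atTop, max |(x : ℝ)| |B k| + 1 < ε / 4 * n :=
    (tendsto_natCast_atTop_atTop.const_mul_atTop
      (show 0 < ε / 4 by positivity)).eventually_gt_atTop _
  have hall := (hl k).and ((hu k).and (hev.and (eventually_gt_atTop 0)))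
  obtain ⟨N, hN⟩ := eventually_atTop.1 hall
  refine ⟨N, fun n hn => ?_⟩
  obtain ⟨h1, h2, h3, h4⟩ := hN n hn.le
  have hn0 : (0 : ℝ) < n := by exact_mod_cast h4
  have hk0 : (0 : ℝ) < (k : ℝ) + 1 := by positivity
  rw [dist_zero_right, norm_div, Real.norm_natCast, div_lt_iff₀ hn0, Real.norm_eq_abs, abs_lt]
  have hx := (le_max_left |(x : ℝ)| |B k|)
  have hBk := (le_max_right |(x : ℝ)| |B k|)
  have hx1 := neg_abs_le (x : ℝ)
  have hB1 := le_abs_self (B k)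
  constructor
  · have : 1 / ((k : ℝ) + 1) * n ≤ ε / 4 * n := by gcongr
    nlinarith
  · have h5 : (X n ω : ℝ) ≤ 1 / ((k : ℝ) + 1) * (2 * n + B k) := by
      rw [one_div_mul_eq_div, le_div_iff₀' hk0]
      exact h2
    have h6 : (2 : ℝ) * n + B k ≤ 2 * n + |B k| := by linarith
    have h7 : 1 / ((k : ℝ) + 1) * (2 * n + B k) ≤ 1 / ((k : ℝ) + 1) * (2 * n + |B k|) := by gcongr
    have h8 : 1 / ((k : ℝ) + 1) * (2 * n) ≤ ε / 4 * (2 * n) := by gcongr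
    have h9 : 1 / ((k : ℝ) + 1) * |B k| ≤ 1 * |B k| := by
      gcongr
      rw [div_le_one hk0]
      linarith [(Nat.cast_nonneg k : (0 : ℝ) ≤ k)]
    nlinarith

end Walk

end

end CookieWalk

theorem proposition3p1 {M : ℕ} (p : CookieWalk.Cookies M) :
    (0 < CookieWalk.alpha p →
      ∃ (π : Measure ℕ) (_ : IsProbabilityMeasure π),
        (∀ z : ℕ, TendstoInDistribution (fun n (Z : ℕ → ℕ) => Z n) atTop (fun k : ℕ => k)
          (fun _ => CookieWalk.chainLaw p z) π) ∧
        Kernel.Invariant (CookieWalk.step p) π ∧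
        (∀ π' : Measure ℕ, IsProbabilityMeasure π' →
          Kernel.Invariant (CookieWalk.step p) π' → π' = π) ∧
        ∫⁻ k, (k : ℝ≥0∞) ^ (M - 1) ∂π = ⊤) ∧
    (M = 2 → ∀ (x : ℤ) (Ω : Type*) [MeasurableSpace Ω] (μ : Measure Ω) (X : ℕ → Ω → ℤ),
      CookieWalk.IsCookieWalk p x μ X → CookieWalk.HasSpeed μ X 0) := by
  refine ⟨fun hα => CookieWalk.ergodic_of_alpha_pos p hα, ?_⟩
  rintro rfl x Ω _ μ X h
  exact h.hasSpeed_zero
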